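/- All linear spaces are over a fixed field $\mathbb K\in\{\mathbb R,\mathbb C\}$. Two Banach spaces $X,Y$ form a *Banach couple* $(X,Y)$ if both are linearly and continuously embedded into some Hausdorff topological vector space. For Banach spaces, $E\hookrightarrow F$ means that $E$ is a linear subspace of $F$ with continuous inclusion, and $E\simeq F$ means that $E$ and $F$ coincide as linear spaces and their norms are equivalent. The intersection $X\cap Y$ and the sum $X+Y$ carry the norms $$\|z\|_{X\cap Y}=\max\{\|z\|_X,\|z\|_Y\},\qquad \|z\|_{X+Y}=\inf\{\|x\|_X+\|y\|_Y : x\in X,\ y\in Y,\ z=x+y\}.$$ A Banach space $Z$ is *intermediate* for $(X,Y)$ if $X\cap Y\hookrightarrow Z\hookrightarrow X+Y$. A *bounded linear operator on the couple* $(X,Y)$ is a linear operator $T:X+Y\to X+Y$ that maps $X$ into $X$ and $Y$ into $Y$ boundedly; put $\|T\|_{L((X,Y))}=\max\{\|T\|_{X\to X},\|T\|_{Y\to Y}\}$. Let $\mathrm{Int}^{R1}(X,Y)$ be the collection of all intermediate spaces $Z$ of $(X,Y)$ for which there is a constant $C>0$ such that every bounded linear operator $T$ of rank one on $(X,Y)$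 maps $Z$ into $Z$ boundedly with $$\|T\|_{Z\to Z}\le C\,\|T\|_{L((X,Y))}.$$ **Theorem 2.8.** Let $(X,Y)$ and $(V,W)$ be two Banach couples with $\mathrm{Int}^{R1}(X,Y)=\mathrm{Int}^{R1}(V,W)$. Then either $X\simeq V$ and $Y\simeq W$, or $X\simeq W$ and $Y\simeq V$. -/

import Mathlib

open Topology

/-- A linear subspace of `E` carrying its own seminorm; the vector space `E` has no topology. -/
structure SeminormedSubspace (𝕜 E : Type*) [RCLike 𝕜] [AddCommGroup E] [Module 𝕜 E] where
  carrier : Submodule 𝕜 E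
  seminorm : Seminorm 𝕜 carrier

namespace SeminormedSubspace

variable {𝕜 E : Type*} [RCLike 𝕜] [AddCommGroup E] [Module 𝕜 E]

noncomputable instance instSeminormedAddCommGroup (X : SeminormedSubspace 𝕜 E) :
    SeminormedAddCommGroup X.carrier :=
  X.seminorm.toAddGroupSeminorm.toSeminormedAddCommGroup

theorem norm_eq (X : SeminormedSubspace 𝕜 E) (x : X.carrier) : ‖x‖ = X.seminorm x := rfl

noncomputable instance instNormedSpace (X : SeminormedSubspace 𝕜 E) :
    NormedSpace 𝕜 X.carrier where
  norm_smul_le a x := (map_smul_eq_mul X.seminorm a x).le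

/-- The topology of the (semi)norm of `X`. -/
noncomputable abbrev normTopology (X : SeminormedSubspace 𝕜 E) :
    TopologicalSpace X.carrier :=
  inferInstance

/-- The seminorm of `X` is a norm, and `X` is complete. -/
def IsBanach (X : SeminormedSubspace 𝕜 E) : Prop :=
  (∀ x : X.carrier, ‖x‖ = 0 → x = 0) ∧ CompleteSpace X.carrier

/-- `X ↪ Y`: `X` is contained in `Y` and the inclusion map is (linear and) continuous. -/
def Embeds (X Y : SeminormedSubspace 𝕜 E) : Prop :=
  ∃ f : X.carrier →L[𝕜] Y.carrier, ∀ x, (f x : E) = x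

/-- `X ≃ Y`: the same linear space, with equivalent norms. -/
def Equivalent (X Y : SeminormedSubspace 𝕜 E) : Prop :=
  X.carrier = Y.carrier ∧
    ∃ c > (0 : ℝ), ∃ C > (0 : ℝ), ∀ (x : X.carrier) (y : Y.carrier), (x : E) = y →
      c * ‖x‖ ≤ ‖y‖ ∧ ‖y‖ ≤ C * ‖x‖

/-- The intersection `X ∩ Y`, with `‖z‖ = max ‖z‖_X ‖z‖_Y`. -/
noncomputable def inter (X Y : SeminormedSubspace 𝕜 E) : SeminormedSubspace 𝕜 E where
  carrier := X.carrier ⊓ Y.carrier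
  seminorm :=
    X.seminorm.comp (Submodule.inclusion inf_le_left) ⊔
      Y.seminorm.comp (Submodule.inclusion inf_le_right)

/-- The numbers `‖x‖_X + ‖y‖_Y` over all the decompositions `z = x + y`. -/
def decompNorms (X Y : SeminormedSubspace 𝕜 E) (z : E) : Set ℝ :=
  {r | ∃ (x : X.carrier) (y : Y.carrier), z = x + y ∧ r = ‖x‖ + ‖y‖}

theorem decompNorms_bddBelow (X Y : SeminormedSubspace 𝕜 E) (z : E) :
    BddBelow (X.decompNorms Y z) := by
  refine ⟨0, ?_⟩
  rintro r ⟨x, y, -, rfl⟩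
  positivity

theorem decompNorms_nonempty (X Y : SeminormedSubspace 𝕜 E) {z : E}
    (hz : z ∈ X.carrier ⊔ Y.carrier) : (X.decompNorms Y z).Nonempty := by
  obtain ⟨x, hx, y, hy, rfl⟩ := Submodule.mem_sup.1 hz
  exact ⟨_, ⟨x, hx⟩, ⟨y, hy⟩, rfl, rfl⟩

/-- The sum `X + Y`, with `‖z‖ = inf {‖x‖_X + ‖y‖_Y : z = x + y}`. -/
noncomputable def sum (X Y : SeminormedSubspace 𝕜 E) : SeminormedSubspace 𝕜 E where
  carrier := X.carrier ⊔ Y.carrier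
  seminorm := Seminorm.ofSMulLE (fun z => sInf (X.decompNorms Y (z : E)))
    (by
      refine le_antisymm (csInf_le (decompNorms_bddBelow X Y _) ⟨0, 0, by simp, by simp⟩) ?_
      refine Real.sInf_nonneg ?_
      rintro r ⟨x, y, -, rfl⟩
      positivity)
    (by
      intro z w
      refine le_of_forall_pos_le_add fun ε hε => ?_
      obtain ⟨r, ⟨x, y, hz, rfl⟩, hr⟩ := exists_lt_of_csInf_lt
        (decompNorms_nonempty X Y z.2) (lt_add_of_pos_right _ (half_pos hε))
      obtain ⟨s, ⟨x', y', hw, rfl⟩, hs⟩ := exists_lt_of_csInf_lt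
        (decompNorms_nonempty X Y w.2) (lt_add_of_pos_right _ (half_pos hε))
      have h := csInf_le (decompNorms_bddBelow X Y ((z + w : ↥(X.carrier ⊔ Y.carrier)) : E))
        ⟨x + x', y + y', by push_cast; rw [hz, hw]; abel, rfl⟩
      have h1 := norm_add_le x x'
      have h2 := norm_add_le y y'
      linarith)
    (by
      intro a z
      refine le_of_forall_pos_le_add fun ε hε => ?_
      have hδ : 0 < ε / (‖a‖ + 1) := by positivity
      obtain ⟨r, ⟨x, y, hz, rfl⟩, hr⟩ := exists_lt_of_csInf_lt
        (decompNorms_nonempty X Y z.2) (lt_add_of_pos_right _ hδ)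
      have h := csInf_le (decompNorms_bddBelow X Y ((a • z : ↥(X.carrier ⊔ Y.carrier)) : E))
        ⟨a • x, a • y, by push_cast; rw [hz, smul_add], rfl⟩
      rw [norm_smul, norm_smul] at h
      have h1 := mul_le_mul_of_nonneg_left hr.le (norm_nonneg a)
      have h2 : ‖a‖ * (ε / (‖a‖ + 1)) ≤ ε := by
        rw [mul_div_assoc', div_le_iff₀ (by positivity)]
        nlinarith [norm_nonneg a]
      linarith)

end SeminormedSubspace

/-- A Banach space whose underlying linear space is a linear subspace of `E`. -/
structure BanachSubspace (𝕜 E : Type*) [RCLike 𝕜] [AddCommGroup E] [Module 𝕜 E] extends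
    SeminormedSubspace 𝕜 E where
  isBanach : toSeminormedSubspace.IsBanach

namespace BanachSubspace

variable {𝕜 E : Type*} [RCLike 𝕜] [AddCommGroup E] [Module 𝕜 E]

/-- `X` and `Y` form a Banach couple: both are continuously embedded into a Hausdorff topological
vector space. The topology on `E` may depend on the couple. -/
def IsCouple (X Y : BanachSubspace 𝕜 E) : Prop :=
  ∃ τ : TopologicalSpace E, IsTopologicalAddGroup E ∧ ContinuousSMul 𝕜 E ∧ T2Space E ∧
    Continuous[X.normTopology, τ] (fun x : X.carrier => (x : E)) ∧
    Continuous[Y.normTopology, τ] (fun y : Y.carrier => (y : E))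

/-- `Z` is an intermediate space for `(X, Y)`: `X ∩ Y ↪ Z ↪ X + Y`. -/
def IsIntermediate (X Y Z : BanachSubspace 𝕜 E) : Prop :=
  (X.inter Y.toSeminormedSubspace).Embeds Z.toSeminormedSubspace ∧
    Z.toSeminormedSubspace.Embeds (X.sum Y.toSeminormedSubspace)

/-- The continuous linear map `S : Z → Z` is the restriction to `Z` of the linear operator `T`,
given on a subspace `F` of `E` (which contains `Z` wherever this is used). -/
def IsRestriction {F : Submodule 𝕜 E} (T : F →ₗ[𝕜] F) (Z : BanachSubspace 𝕜 E)
    (S : Z.carrier →L[𝕜] Z.carrier) : Prop :=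
  ∀ (s : F) (z : Z.carrier), (s : E) = z → (T s : E) = S z

/-- A bounded linear operator on the couple `(X, Y)`: a linear operator `T` in `X + Y` which maps
`X` into `X` and `Y` into `Y` boundedly. The restrictions are determined by `T`. -/
structure CoupleOperator (X Y : BanachSubspace 𝕜 E) where
  toLinearMap : ↥(X.carrier ⊔ Y.carrier) →ₗ[𝕜] ↥(X.carrier ⊔ Y.carrier)
  left : X.carrier →L[𝕜] X.carrier
  right : Y.carrier →L[𝕜] Y.carrier
  isRestriction_left : IsRestriction toLinearMap X left
  isRestriction_right : IsRestriction toLinearMap Y right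

/-- The norm of an operator on a couple: `max ‖T‖_{X → X} ‖T‖_{Y → Y}`. -/
noncomputable def CoupleOperator.opNorm {X Y : BanachSubspace 𝕜 E} (T : CoupleOperator X Y) : ℝ :=
  max ‖T.left‖ ‖T.right‖

/-- The operator has rank one. -/
def CoupleOperator.IsRankOne {X Y : BanachSubspace 𝕜 E} (T : CoupleOperator X Y) : Prop :=
  Module.finrank 𝕜 (LinearMap.range T.toLinearMap) = 1

/-- The collection of the interpolation spaces for the operators of rank one on `(X, Y)`: the
intermediate spaces `Z` such that, for some `C > 0`, every operator `T` of rank one on `(X, Y)`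
maps `Z` into `Z` boundedly, with `‖T‖_{Z → Z} ≤ C ‖T‖`. -/
def rankOneInterpolationSpaces (X Y : BanachSubspace 𝕜 E) : Set (BanachSubspace 𝕜 E) :=
  {Z | IsIntermediate X Y Z ∧
    ∃ C > (0 : ℝ), ∀ T : CoupleOperator X Y, T.IsRankOne →
      ∃ S : Z.carrier →L[𝕜] Z.carrier, IsRestriction T.toLinearMap Z S ∧ ‖S‖ ≤ C * T.opNorm}

/-- `(X, Y) ≃ (V, W)`: the spaces of the two couples are equivalent, in this or the other order. -/
def CoupleEquivalent (X Y V W : BanachSubspace 𝕜 E) : Prop :=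
  (X.Equivalent V.toSeminormedSubspace ∧ Y.Equivalent W.toSeminormedSubspace) ∨
    (X.Equivalent W.toSeminormedSubspace ∧ Y.Equivalent V.toSeminormedSubspace)

end BanachSubspace

/-! The sum and the intersection of a couple are themselves rank one interpolation spaces, the
largest and the smallest ones. So both couples have the same sum and the same intersection up to
equivalent norms, and each of the four spaces is an interpolation space for the other couple. By the
closed graph theorem it is enough to match the underlying linear spaces.

An operator `f ⊗ u` with `f` in `(X + Y)*` and `u` in `X ∩ Y` gives the test `‖f‖_{Z*} ‖u‖_Z ≤ C max
(‖f‖_{X*} ‖u‖_X, ‖f‖_{Y*} ‖u‖_Y)`. If `X` is not contained in `Y`, then `Y` is not the whole sum,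
and by the surjectivity criterion some functionals are almost invisible on `Y`; the test then bounds
the norm of `V` or that of `W` by the norm of `X` on the intersection
(`dominatedOn_left_of_not_le`). When neither couple is nested, such comparisons in all roles pair up
the four norms on the intersection (`pairs_equivalent_of_upper_bounds`), so the closures of the
intersection in paired spaces agree.

What lies beyond these closures is seen by functionals on `X` that vanish on `X ∩ Y`, extended by
zero to `Y`. For them `u` may be any vector of `X`, so either `X ⊆ V`, or `V` lies in `Y` plus the
closure of `X ∩ Y` in `X` (`le_or_le_sup_closureIn`). These alternatives, together with the common
sum and intersection, determine the spaces by a computation in the modular lattice of subspaces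
(`eq_and_eq_or_eq_and_eq`).

If one couple is nested, so is the other (`le_or_le_of_le`), and then the spaces are the sum and the
intersection. -/

/-! ### Surjectivity from the adjoint, and separation from a subspace -/

/-- An operator into a normed space whose adjoint is bounded below has approximate preimages. -/
theorem ContinuousLinearMap.exists_approx_preimage_of_norm_le_norm_comp {𝕜 F G : Type*} [RCLike 𝕜]
    [NormedAddCommGroup F] [NormedSpace 𝕜 F] [NormedAddCommGroup G] [NormedSpace 𝕜 G]
    (A : F →L[𝕜] G) {K : ℝ} (hK0 : 0 ≤ K) (hK : ∀ f : G →L[𝕜] 𝕜, ‖f‖ ≤ K * ‖f.comp A‖) {r : ℝ}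
    (hr : 0 < r) {y : G} (hy : ‖y‖ ≤ r) : ∃ x : F, ‖x‖ ≤ (K + 1) * r ∧ ‖y - A x‖ ≤ r / 2 := by
  have hR : 0 < (K + 1) * r := by positivity
  have hmem : y ∈ closure (A '' Metric.closedBall 0 ((K + 1) * r)) := by
    let : NormedSpace ℝ F := NormedSpace.restrictScalars ℝ 𝕜 F
    let : NormedSpace ℝ G := NormedSpace.restrictScalars ℝ 𝕜 G
    have : IsScalarTower ℝ 𝕜 F := ⟨fun a b c => by
      change ((a • b) • c) = ((a : 𝕜) • (b • c)); rw [smul_smul, RCLike.real_smul_eq_coe_mul]⟩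
    have : IsScalarTower ℝ 𝕜 G := ⟨fun a b c => by
      change ((a • b) • c) = ((a : 𝕜) • (b • c)); rw [smul_smul, RCLike.real_smul_eq_coe_mul]⟩
    -- A functional `f` separating `y` from the closed convex image has `re f < u` on it, hence `‖f
    -- ∘ A‖ ≤ u / ((K + 1) r)`. Then `re (f y) ≤ ‖f‖ r ≤ u K / (K + 1) < u`, which is absurd; the `+
    -- 1` makes this strict.
    by_contra hcon
    have hconv : Convex ℝ (closure (A '' Metric.closedBall 0 ((K + 1) * r))) :=
      ((convex_closedBall (0 : F) _).linear_image (A.toLinearMap.restrictScalars ℝ)).closure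
    obtain ⟨f, u, hfu, huy⟩ :=
      RCLike.geometric_hahn_banach_closed_point (𝕜 := 𝕜) hconv isClosed_closure hcon
    have hu : 0 < u := by
      simpa using hfu 0 (subset_closure ⟨0, by simpa using hR.le, by simp⟩)
    have hball : ∀ x ∈ Metric.closedBall (0 : F) ((K + 1) * r), ‖f.comp A x‖ ≤ u := by
      intro x hx
      -- Rotating `x` by a unimodular scalar turns the bound on the real part into a bound on the
      -- norm.
      obtain ⟨c, hc, hcx⟩ := RCLike.exists_norm_eq_mul_self (f (A x))
      have := hfu (A (c • x)) (subset_closure ⟨c • x, by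
        simpa [norm_smul, hc] using hx, rfl⟩)
      rw [map_smul, map_smul, smul_eq_mul, ← hcx, RCLike.ofReal_re] at this
      exact this.le
    have hfA : ‖f.comp A‖ ≤ u / ((K + 1) * r) :=
      ContinuousLinearMap.opNorm_bound_of_ball_bound hR u _ hball
    have h1 : RCLike.re (f y) ≤ ‖f‖ * r :=
      (RCLike.re_le_norm _).trans ((f.le_opNorm y).trans (by gcongr))
    have h2 : ‖f‖ * r ≤ K * (u / ((K + 1) * r)) * r := by
      gcongr
      exact (hK f).trans (by gcongr)
    have h3 : K * (u / ((K + 1) * r)) * r = u * (K / (K + 1)) := by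
      field_simp
    have h4 : u * (K / (K + 1)) ≤ u * 1 := by
      gcongr
      rw [div_le_one (by positivity)]
      linarith
    linarith
  obtain ⟨_, ⟨x, hx, rfl⟩, hxy⟩ := Metric.mem_closure_iff.1 hmem (r / 2) (by positivity)
  exact ⟨x, by simpa using hx, by rw [← dist_eq_norm]; exact hxy.le⟩

/-- An operator from a Banach space into a normed space is onto if its adjoint is bounded below. -/
theorem ContinuousLinearMap.surjective_of_norm_le_norm_comp {𝕜 F G : Type*} [RCLike 𝕜]
    [NormedAddCommGroup F] [NormedSpace 𝕜 F] [CompleteSpace F] [NormedAddCommGroup G]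
    [NormedSpace 𝕜 G] (A : F →L[𝕜] G) {K : ℝ} (hK0 : 0 ≤ K)
    (hK : ∀ f : G →L[𝕜] 𝕜, ‖f‖ ≤ K * ‖f.comp A‖) : Function.Surjective A := by
  intro y
  -- Successive approximation: the residual is halved at each step. The hypothesis on `z` sits
  -- inside the existential so that `g n z` is defined for all `z` and can be iterated; `‖y‖ + 1`
  -- keeps the radius positive when `y = 0`.
  have happ : ∀ (n : ℕ) (z : G), ∃ x : F, ‖z‖ ≤ (‖y‖ + 1) * (1 / 2) ^ n →
      ‖x‖ ≤ (K + 1) * ((‖y‖ + 1) * (1 / 2) ^ n) ∧ ‖z - A x‖ ≤ (‖y‖ + 1) * (1 / 2) ^ (n + 1) := by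
    intro n z
    by_cases hz : ‖z‖ ≤ (‖y‖ + 1) * (1 / 2) ^ n
    · obtain ⟨x, hx, hxz⟩ := A.exists_approx_preimage_of_norm_le_norm_comp hK0 hK
        (by positivity) hz
      exact ⟨x, fun _ => ⟨hx, hxz.trans_eq (by ring)⟩⟩
    · exact ⟨0, fun h => absurd h hz⟩
  choose g hg using happ
  let s : ℕ → G := fun n => Nat.rec y (fun k z => z - A (g k z)) n
  have hs : ∀ n, s (n + 1) = s n - A (g n (s n)) := fun n => rfl
  have hsn : ∀ n, ‖s n‖ ≤ (‖y‖ + 1) * (1 / 2) ^ n := by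
    intro n
    induction n with
    | zero => simp [s]
    | succ n ih => rw [hs]; exact (hg n _ ih).2
  have hsum : Summable fun n => g n (s n) := by
    refine Summable.of_norm_bounded ?_ fun n => (hg n _ (hsn n)).1
    exact (summable_geometric_two.mul_left _).mul_left _
  refine ⟨∑' n, g n (s n), ?_⟩
  have hpart : ∀ n, A (∑ i ∈ Finset.range n, g i (s i)) = y - s n := by
    intro n
    induction n with
    | zero => simp [s]
    | succ n ih => rw [Finset.sum_range_succ, map_add, ih, hs]; abel
  have h1 := (A.continuous.tendsto _).comp hsum.hasSum.tendsto_sum_nat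
  have h0 : Filter.Tendsto s Filter.atTop (𝓝 0) := by
    refine squeeze_zero_norm hsn ?_
    simpa using (tendsto_pow_atTop_nhds_zero_of_lt_one (r := (1 / 2 : ℝ)) (by norm_num)
      (by norm_num)).const_mul (‖y‖ + 1)
  have h2 : Filter.Tendsto (fun n => y - s n) Filter.atTop (𝓝 (y - 0)) := h0.const_sub y
  rw [sub_zero] at h2
  exact tendsto_nhds_unique (h1.congr hpart) h2

/-- A point outside the closure of a subspace is separated from it by a bounded functional. -/
theorem Submodule.exists_continuousLinearMap_ne_zero_of_notMem_topologicalClosure {𝕜 F : Type*}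
    [RCLike 𝕜] [SeminormedAddCommGroup F] [NormedSpace 𝕜 F] (p : Submodule 𝕜 F) {x : F}
    (hx : x ∉ p.topologicalClosure) : ∃ f : F →L[𝕜] 𝕜, (∀ y ∈ p, f y = 0) ∧ f x ≠ 0 := by
  -- `p` need not be closed, so the quotient is only seminormed; the vectors of seminorm zero are
  -- the classes of points in the closure of `p`.
  have hne : ‖(p.mkQ x : F ⧸ p)‖ ≠ 0 := by
    intro h0
    apply hx
    have : x ∈ closure (p : Set F) := by
      have := (QuotientAddGroup.norm_mk_eq_zero_iff_mem_closure (S := p.toAddSubgroup) (m := x)).1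
      exact this h0
    exact this
  obtain ⟨g, -, hg⟩ := exists_dual_vector 𝕜 _ hne
  refine ⟨g.comp p.mkQL, fun y hy => ?_, ?_⟩
  · have : p.mkQ y = 0 := by simpa using hy
    change g (p.mkQ y) = 0
    rw [this, map_zero]
  · change g (p.mkQ x) ≠ 0
    rw [hg]
    exact_mod_cast hne

/-! ### Embeddings, sums and intersections of seminormed subspaces -/

namespace SeminormedSubspace

variable {𝕜 E : Type*} [RCLike 𝕜] [AddCommGroup E] [Module 𝕜 E]

open Classical in
/-- The norm of `X` as a function on the whole of `E`, with the value `0` outside of `X`. -/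
noncomputable def normOf (X : SeminormedSubspace 𝕜 E) (e : E) : ℝ :=
  if h : e ∈ X.carrier then ‖(⟨e, h⟩ : X.carrier)‖ else 0

theorem normOf_coe (X : SeminormedSubspace 𝕜 E) (x : X.carrier) : X.normOf x = ‖x‖ := by
  simp [normOf]

theorem normOf_mk (X : SeminormedSubspace 𝕜 E) {e : E} (h : e ∈ X.carrier) :
    ‖(⟨e, h⟩ : X.carrier)‖ = X.normOf e := by
  simp [normOf, h]

theorem normOf_nonneg (X : SeminormedSubspace 𝕜 E) (e : E) : 0 ≤ X.normOf e := by
  unfold normOf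
  split_ifs
  · exact norm_nonneg _
  · exact le_rfl

theorem Embeds.le {X Y : SeminormedSubspace 𝕜 E} (h : X.Embeds Y) : X.carrier ≤ Y.carrier := by
  obtain ⟨f, hf⟩ := h
  intro x hx
  have := (f ⟨x, hx⟩).2
  rwa [hf] at this

theorem Embeds.exists_bound {X Y : SeminormedSubspace 𝕜 E} (h : X.Embeds Y) :
    ∃ C > 0, ∀ x ∈ X.carrier, Y.normOf x ≤ C * X.normOf x := by
  obtain ⟨f, hf⟩ := h
  obtain ⟨C, hC, hfC⟩ := f.bound
  refine ⟨C, hC, fun x hx => ?_⟩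
  have := hfC ⟨x, hx⟩
  rwa [← normOf_coe, ← normOf_coe, hf] at this

theorem Embeds.of_bound {X Y : SeminormedSubspace 𝕜 E} (hle : X.carrier ≤ Y.carrier) (C : ℝ)
    (h : ∀ x ∈ X.carrier, Y.normOf x ≤ C * X.normOf x) : X.Embeds Y :=
  ⟨(Submodule.inclusion hle).mkContinuous C fun x => by
    rw [← normOf_coe, ← normOf_coe]; exact h _ x.2, fun _ => rfl⟩

theorem Embeds.refl (X : SeminormedSubspace 𝕜 E) : X.Embeds X :=
  ⟨ContinuousLinearMap.id 𝕜 _, fun _ => rfl⟩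

theorem Embeds.trans {X Y Z : SeminormedSubspace 𝕜 E} (h : X.Embeds Y) (h' : Y.Embeds Z) :
    X.Embeds Z := by
  obtain ⟨f, hf⟩ := h
  obtain ⟨g, hg⟩ := h'
  exact ⟨g.comp f, fun x => by simp [hf, hg]⟩

theorem Equivalent.of_embeds {X Y : SeminormedSubspace 𝕜 E} (h : X.Embeds Y) (h' : Y.Embeds X) :
    X.Equivalent Y := by
  obtain ⟨C, hC, hXY⟩ := h.exists_bound
  obtain ⟨c, hc, hYX⟩ := h'.exists_bound
  refine ⟨le_antisymm h.le h'.le, c⁻¹, inv_pos.2 hc, C, hC, fun x y hxy => ?_⟩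
  have h1 := hXY x x.2
  have h2 := hYX y y.2
  rw [← hxy, normOf_coe] at h2
  rw [normOf_coe] at h1
  rw [← normOf_coe Y, ← hxy]
  exact ⟨by rwa [inv_mul_le_iff₀ hc], h1⟩

theorem normOf_inter (X Y : SeminormedSubspace 𝕜 E) {z : E} (hX : z ∈ X.carrier)
    (hY : z ∈ Y.carrier) : (X.inter Y).normOf z = max (X.normOf z) (Y.normOf z) := by
  rw [← normOf_mk (X.inter Y) (Submodule.mem_inf.2 ⟨hX, hY⟩), ← normOf_mk X hX, ← normOf_mk Y hY]
  rfl

theorem normOf_sum_le (X Y : SeminormedSubspace 𝕜 E) {x y : E} (hx : x ∈ X.carrier)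
    (hy : y ∈ Y.carrier) : (X.sum Y).normOf (x + y) ≤ X.normOf x + Y.normOf y := by
  rw [← normOf_mk (X.sum Y) (Submodule.add_mem_sup hx hy)]
  refine csInf_le (decompNorms_bddBelow X Y _) ⟨⟨x, hx⟩, ⟨y, hy⟩, rfl, ?_⟩
  rw [normOf_mk, normOf_mk]

theorem exists_lt_normOf_sum (X Y : SeminormedSubspace 𝕜 E) {z : E} (hz : z ∈ (X.sum Y).carrier)
    {ε : ℝ} (hε : 0 < ε) : ∃ x ∈ X.carrier, ∃ y ∈ Y.carrier, z = x + y ∧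
      X.normOf x + Y.normOf y < (X.sum Y).normOf z + ε := by
  have h : sInf (X.decompNorms Y z) < (X.sum Y).normOf z + ε := by
    rw [← normOf_mk (X.sum Y) hz]
    exact lt_add_of_pos_right _ hε
  obtain ⟨r, ⟨x, y, hxy, rfl⟩, hr⟩ := exists_lt_of_csInf_lt (decompNorms_nonempty X Y hz) h
  exact ⟨x, x.2, y, y.2, hxy, by rwa [normOf_coe, normOf_coe]⟩

theorem normOf_zero (X : SeminormedSubspace 𝕜 E) : X.normOf 0 = 0 := by
  simpa using X.normOf_coe 0

theorem embeds_sum_left (X Y : SeminormedSubspace 𝕜 E) : X.Embeds (X.sum Y) :=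
  Embeds.of_bound le_sup_left 1 fun x hx => by
    simpa [normOf_zero] using normOf_sum_le X Y hx Y.carrier.zero_mem

theorem embeds_sum_right (X Y : SeminormedSubspace 𝕜 E) : Y.Embeds (X.sum Y) :=
  Embeds.of_bound le_sup_right 1 fun y hy => by
    simpa [normOf_zero] using normOf_sum_le X Y X.carrier.zero_mem hy

theorem inter_embeds_left (X Y : SeminormedSubspace 𝕜 E) : (X.inter Y).Embeds X :=
  Embeds.of_bound inf_le_left 1 fun x hx => by
    rw [one_mul, normOf_inter X Y hx.1 hx.2]; exact le_max_left _ _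

theorem inter_embeds_right (X Y : SeminormedSubspace 𝕜 E) : (X.inter Y).Embeds Y :=
  Embeds.of_bound inf_le_right 1 fun x hx => by
    rw [one_mul, normOf_inter X Y hx.1 hx.2]; exact le_max_right _ _

theorem sum_embeds_sum_swap (X Y : SeminormedSubspace 𝕜 E) : (X.sum Y).Embeds (Y.sum X) := by
  refine Embeds.of_bound (sup_comm X.carrier Y.carrier).le 1 fun z hz => ?_
  refine le_of_forall_pos_le_add fun ε hε => ?_
  obtain ⟨x, hx, y, hy, rfl, h⟩ := exists_lt_normOf_sum X Y hz hε
  rw [one_mul]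
  have := normOf_sum_le Y X hy hx
  rw [add_comm y x] at this
  linarith

theorem inter_embeds_inter_swap (X Y : SeminormedSubspace 𝕜 E) :
    (X.inter Y).Embeds (Y.inter X) := by
  refine Embeds.of_bound (inf_comm X.carrier Y.carrier).le 1 fun z hz => ?_
  rw [normOf_inter X Y hz.1 hz.2, normOf_inter Y X hz.2 hz.1, max_comm, one_mul]

/-- The restriction of a functional to a smaller space. -/
noncomputable def Embeds.restrict {Z S : SeminormedSubspace 𝕜 E} (h : Z.Embeds S)
    (f : S.carrier →L[𝕜] 𝕜) : Z.carrier →L[𝕜] 𝕜 :=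
  f.comp h.choose

theorem Embeds.restrict_apply {Z S : SeminormedSubspace 𝕜 E} (h : Z.Embeds S)
    (f : S.carrier →L[𝕜] 𝕜) (z : Z.carrier) {s : S.carrier} (hs : (s : E) = z) :
    h.restrict f z = f s := by
  have : h.choose z = s := Subtype.ext (by rw [h.choose_spec, hs])
  exact congrArg f this

theorem Embeds.norm_apply_le {Z S : SeminormedSubspace 𝕜 E} (h : Z.Embeds S)
    (f : S.carrier →L[𝕜] 𝕜) (s : S.carrier) (hs : (s : E) ∈ Z.carrier) :
    ‖f s‖ ≤ ‖h.restrict f‖ * Z.normOf s := by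
  have h1 := (h.restrict f).le_opNorm ⟨s, hs⟩
  rwa [h.restrict_apply f ⟨s, hs⟩ rfl, normOf_mk] at h1

end SeminormedSubspace

/-! ### Completeness of the sum and the intersection; continuity of inclusions -/

namespace BanachSubspace

variable {𝕜 E : Type*} [RCLike 𝕜] [AddCommGroup E] [Module 𝕜 E]

noncomputable instance instNormedAddCommGroup (X : BanachSubspace 𝕜 E) :
    NormedAddCommGroup X.carrier :=
  NormedAddCommGroup.ofSeparation X.isBanach.1

instance instCompleteSpace (X : BanachSubspace 𝕜 E) : CompleteSpace X.carrier :=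
  X.isBanach.2

/-- The only fact drawn from the Hausdorff topology of a couple: it makes limits taken in `X` and in
`Y` compatible. -/
theorem IsCouple.eq_zero {X Y : BanachSubspace 𝕜 E} (h : IsCouple X Y) {z : E}
    {x : ℕ → X.carrier} {y : ℕ → Y.carrier} (hx : Filter.Tendsto x Filter.atTop (𝓝 0))
    (hy : Filter.Tendsto y Filter.atTop (𝓝 0)) (hz : ∀ n, z = x n + y n) : z = 0 := by
  obtain ⟨τ, hadd, -, hT2, hX, hY⟩ := h
  have h1 := (@Continuous.tendsto _ _ X.normTopology τ _ hX 0).comp hx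
  have h2 := (@Continuous.tendsto _ _ Y.normTopology τ _ hY 0).comp hy
  have h3 := h1.add h2
  have h4 : Filter.Tendsto (fun _ : ℕ => z) Filter.atTop (𝓝 z) := tendsto_const_nhds
  have h5 := tendsto_nhds_unique h4 (h3.congr fun n => (hz n).symm)
  simpa using h5

theorem eq_zero_of_normOf_eq_zero {X : BanachSubspace 𝕜 E} {x : E} (hx : x ∈ X.carrier)
    (h : X.normOf x = 0) : x = 0 := by
  rw [← SeminormedSubspace.normOf_mk _ hx] at h
  exact congrArg Subtype.val (X.isBanach.1 _ h)

/-- An absolutely convergent series in the sum splits, by nearly optimal decompositions with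
summable errors, into absolutely convergent series in `X` and in `Y`. -/
theorem IsCouple.isBanach_sum {X Y : BanachSubspace 𝕜 E} (h : IsCouple X Y) :
    (X.sum Y.toSeminormedSubspace).IsBanach := by
  have hsep : ∀ z : (X.sum Y.toSeminormedSubspace).carrier, ‖z‖ = 0 → z = 0 := by
    intro z hz
    have hd : ∀ n : ℕ, ∃ x : X.carrier, ∃ y : Y.carrier, (z : E) = x + y ∧
        ‖x‖ + ‖y‖ < 1 / ((n : ℝ) + 1) := by
      intro n
      obtain ⟨x, hx, y, hy, hxy, hlt⟩ := SeminormedSubspace.exists_lt_normOf_sum _ _ z.2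
        (ε := 1 / ((n : ℝ) + 1)) (by positivity)
      refine ⟨⟨x, hx⟩, ⟨y, hy⟩, hxy, ?_⟩
      rw [SeminormedSubspace.normOf_coe, hz, zero_add] at hlt
      rwa [SeminormedSubspace.normOf_mk, SeminormedSubspace.normOf_mk]
    choose x y hxy hlt using hd
    have hlim := tendsto_one_div_add_atTop_nhds_zero_nat (𝕜 := ℝ)
    refine Subtype.ext (h.eq_zero (x := x) (y := y) ?_ ?_ hxy)
    · exact squeeze_zero_norm (fun n => by linarith [hlt n, norm_nonneg (y n)]) hlim
    · exact squeeze_zero_norm (fun n => by linarith [hlt n, norm_nonneg (x n)]) hlim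
  refine ⟨hsep, ?_⟩
  let : NormedAddCommGroup (X.sum Y.toSeminormedSubspace).carrier :=
    NormedAddCommGroup.ofSeparation hsep
  refine NormedAddCommGroup.completeSpace_of_summable_imp_tendsto fun u hu => ?_
  have hd : ∀ n : ℕ, ∃ x : X.carrier, ∃ y : Y.carrier, (u n : E) = x + y ∧
      ‖x‖ + ‖y‖ < ‖u n‖ + (1 / 2) ^ n := by
    intro n
    obtain ⟨x, hx, y, hy, hxy, hlt⟩ := SeminormedSubspace.exists_lt_normOf_sum _ _ (u n).2
      (ε := (1 / 2) ^ n) (by positivity)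
    refine ⟨⟨x, hx⟩, ⟨y, hy⟩, hxy, ?_⟩
    rw [SeminormedSubspace.normOf_coe] at hlt
    rwa [SeminormedSubspace.normOf_mk, SeminormedSubspace.normOf_mk]
  choose x y hxy hlt using hd
  have hb := hu.add summable_geometric_two
  have hx : Summable x := hb.of_norm_bounded fun n => by linarith [hlt n, norm_nonneg (y n)]
  have hy : Summable y := hb.of_norm_bounded fun n => by linarith [hlt n, norm_nonneg (x n)]
  obtain ⟨i, hi⟩ := SeminormedSubspace.embeds_sum_left X.toSeminormedSubspace
    Y.toSeminormedSubspace
  obtain ⟨j, hj⟩ := SeminormedSubspace.embeds_sum_right X.toSeminormedSubspace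
    Y.toSeminormedSubspace
  refine ⟨i (∑' n, x n) + j (∑' n, y n), ?_⟩
  have h1 := ((i.continuous.tendsto _).comp hx.hasSum.tendsto_sum_nat).add
    ((j.continuous.tendsto _).comp hy.hasSum.tendsto_sum_nat)
  refine h1.congr fun n => ?_
  simp only [Function.comp_apply, map_sum, ← Finset.sum_add_distrib]
  refine Finset.sum_congr rfl fun k _ => Subtype.ext ?_
  rw [hxy k, ← hi, ← hj]
  rfl

theorem IsCouple.isBanach_inter {X Y : BanachSubspace 𝕜 E} (h : IsCouple X Y) :
    (X.inter Y.toSeminormedSubspace).IsBanach := by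
  have hsep : ∀ z : (X.inter Y.toSeminormedSubspace).carrier, ‖z‖ = 0 → z = 0 := by
    intro z hz
    refine Subtype.ext (eq_zero_of_normOf_eq_zero (X := X) z.2.1 ?_)
    rw [← SeminormedSubspace.normOf_coe, SeminormedSubspace.normOf_inter _ _ z.2.1 z.2.2] at hz
    exact le_antisymm ((le_max_left _ _).trans hz.le) (SeminormedSubspace.normOf_nonneg _ _)
  refine ⟨hsep, ?_⟩
  obtain ⟨i, hi⟩ := SeminormedSubspace.inter_embeds_left X.toSeminormedSubspace
    Y.toSeminormedSubspace
  obtain ⟨j, hj⟩ := SeminormedSubspace.inter_embeds_right X.toSeminormedSubspace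
    Y.toSeminormedSubspace
  refine Metric.complete_of_cauchySeq_tendsto fun u hu => ?_
  obtain ⟨x, hx⟩ := cauchySeq_tendsto_of_complete (i.uniformContinuous.comp_cauchySeq hu)
  obtain ⟨y, hy⟩ := cauchySeq_tendsto_of_complete (j.uniformContinuous.comp_cauchySeq hu)
  have hxy : (x : E) - y = 0 := by
    refine h.eq_zero (x := fun n => x - i (u n)) (y := fun n => j (u n) - y) ?_ ?_ fun n => ?_
    · simpa using hx.const_sub x
    · simpa using hy.sub_const y
    · have h1 := hi (u n)
      have h2 := hj (u n)
      push_cast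
      rw [h1, h2]
      abel
  rw [sub_eq_zero] at hxy
  let z : (X.inter Y.toSeminormedSubspace).carrier := ⟨x, x.2, hxy ▸ y.2⟩
  refine ⟨z, ?_⟩
  rw [tendsto_iff_norm_sub_tendsto_zero] at hx hy ⊢
  have h3 := hx.max hy
  rw [max_self] at h3
  refine h3.congr fun n => ?_
  have hz := (u n - z).2
  rw [← SeminormedSubspace.normOf_coe (X.inter Y.toSeminormedSubspace),
    SeminormedSubspace.normOf_inter _ _ hz.1 hz.2,
    ← SeminormedSubspace.normOf_coe, ← SeminormedSubspace.normOf_coe]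
  simp only [Function.comp_apply, Submodule.coe_sub, hi, hj, ← hxy, z]

/-- The sum of the spaces of a couple, as a Banach space. -/
noncomputable def IsCouple.sum {X Y : BanachSubspace 𝕜 E} (h : IsCouple X Y) :
    BanachSubspace 𝕜 E :=
  ⟨X.toSeminormedSubspace.sum Y.toSeminormedSubspace, h.isBanach_sum⟩

/-- The intersection of the spaces of a couple, as a Banach space. -/
noncomputable def IsCouple.inter {X Y : BanachSubspace 𝕜 E} (h : IsCouple X Y) :
    BanachSubspace 𝕜 E :=
  ⟨X.toSeminormedSubspace.inter Y.toSeminormedSubspace, h.isBanach_inter⟩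

/-- Inside of a Banach space, inclusions of Banach subspaces are continuous. -/
theorem embeds_of_le {X Y S : BanachSubspace 𝕜 E}
    (hX : X.Embeds S.toSeminormedSubspace) (hY : Y.Embeds S.toSeminormedSubspace)
    (hle : X.carrier ≤ Y.carrier) : X.Embeds Y.toSeminormedSubspace := by
  obtain ⟨i, hi⟩ := hX
  obtain ⟨j, hj⟩ := hY
  have hc : Continuous (Submodule.inclusion hle) := by
    refine LinearMap.continuous_of_seq_closed_graph _ fun u x y hx hy => ?_
    have h1 := (i.continuous.tendsto _).comp hx
    have h2 := (j.continuous.tendsto _).comp hy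
    have h3 : i x = j y := by
      refine tendsto_nhds_unique h1 (h2.congr fun n => Subtype.ext ?_)
      simp [hi, hj]
    have h4 := congrArg Subtype.val h3
    rw [hi, hj] at h4
    exact Subtype.ext h4.symm
  exact ⟨⟨_, hc⟩, fun _ => rfl⟩

end BanachSubspace

/-! ### Rank one interpolation spaces and the rank one test -/

namespace BanachSubspace

variable {𝕜 E : Type*} [RCLike 𝕜] [AddCommGroup E] [Module 𝕜 E]

open SeminormedSubspace

theorem left_mem_rankOneInterpolationSpaces (X Y : BanachSubspace 𝕜 E) :
    X ∈ rankOneInterpolationSpaces X Y :=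
  ⟨⟨inter_embeds_left _ _, embeds_sum_left _ _⟩, 1, one_pos, fun T _ =>
    ⟨T.left, T.isRestriction_left, by rw [one_mul]; exact le_max_left _ _⟩⟩

theorem CoupleOperator.opNorm_nonneg {X Y : BanachSubspace 𝕜 E} (T : CoupleOperator X Y) :
    0 ≤ T.opNorm :=
  (norm_nonneg _).trans (le_max_left _ _)

theorem CoupleOperator.normOf_left_le {X Y : BanachSubspace 𝕜 E} (T : CoupleOperator X Y)
    {x : E} (hx : x ∈ X.carrier) :
    X.normOf (T.left ⟨x, hx⟩) ≤ T.opNorm * X.normOf x := by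
  rw [normOf_coe, ← normOf_mk _ hx]
  exact (T.left.le_opNorm _).trans (by gcongr; exact le_max_left _ _)

theorem CoupleOperator.normOf_right_le {X Y : BanachSubspace 𝕜 E} (T : CoupleOperator X Y)
    {y : E} (hy : y ∈ Y.carrier) :
    Y.normOf (T.right ⟨y, hy⟩) ≤ T.opNorm * Y.normOf y := by
  rw [normOf_coe, ← normOf_mk _ hy]
  exact (T.right.le_opNorm _).trans (by gcongr; exact le_max_right _ _)

/-- Every intermediate space embeds into the sum, so this membership is what carries the sum of one
couple over to the other; the intersection plays the dual role. -/
theorem IsCouple.sum_mem_rankOneInterpolationSpaces {X Y : BanachSubspace 𝕜 E}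
    (h : IsCouple X Y) : h.sum ∈ rankOneInterpolationSpaces X Y := by
  refine ⟨⟨(inter_embeds_left _ _).trans (embeds_sum_left _ _), Embeds.refl _⟩, 1, one_pos,
    fun T _ => ?_⟩
  let S : h.sum.carrier →ₗ[𝕜] h.sum.carrier := T.toLinearMap
  have hb : ∀ z : h.sum.carrier, ‖S z‖ ≤ T.opNorm * ‖z‖ := by
    intro z
    refine le_of_forall_pos_le_add fun ε hε => ?_
    have hδ : 0 < ε / (T.opNorm + 1) := div_pos hε (by linarith [T.opNorm_nonneg])
    obtain ⟨x, hx, y, hy, hxy, hlt⟩ := exists_lt_normOf_sum X.toSeminormedSubspace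
      Y.toSeminormedSubspace z.2 hδ
    have hz : z = ⟨x, (embeds_sum_left _ _).le hx⟩ + ⟨y, (embeds_sum_right _ _).le hy⟩ :=
      Subtype.ext hxy
    have hT : (T.toLinearMap z : E) = T.left ⟨x, hx⟩ + T.right ⟨y, hy⟩ := by
      rw [← T.isRestriction_left ⟨x, (embeds_sum_left _ _).le hx⟩ ⟨x, hx⟩ rfl,
        ← T.isRestriction_right ⟨y, (embeds_sum_right _ _).le hy⟩ ⟨y, hy⟩ rfl, hz]
      exact congrArg Subtype.val (map_add T.toLinearMap _ _)
    have h1 := normOf_sum_le X.toSeminormedSubspace Y.toSeminormedSubspace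
      (T.left ⟨x, hx⟩).2 (T.right ⟨y, hy⟩).2
    rw [← hT] at h1
    have h2 := T.normOf_left_le hx
    have h3 := T.normOf_right_le hy
    have h4 : T.opNorm * (ε / (T.opNorm + 1)) ≤ ε := by
      rw [mul_div_assoc', div_le_iff₀ (by linarith [T.opNorm_nonneg])]
      nlinarith [T.opNorm_nonneg]
    have h5 := mul_le_mul_of_nonneg_left hlt.le T.opNorm_nonneg
    have h6 : ‖S z‖ =
        (X.sum Y.toSeminormedSubspace).normOf (T.toLinearMap z) :=
      (normOf_coe (X.sum Y.toSeminormedSubspace) (T.toLinearMap z)).symm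
    have h7 : (X.sum Y.toSeminormedSubspace).normOf z = ‖z‖ :=
      normOf_coe (X.sum Y.toSeminormedSubspace) z
    rw [h6, ← h7]
    linarith
  refine ⟨S.mkContinuous _ hb,
    fun s z hsz => ?_, ?_⟩
  · have : s = z := Subtype.ext hsz
    rw [this]
    rfl
  · rw [one_mul]
    exact S.mkContinuous_norm_le T.opNorm_nonneg _

theorem IsCouple.inter_mem_rankOneInterpolationSpaces {X Y : BanachSubspace 𝕜 E}
    (h : IsCouple X Y) : h.inter ∈ rankOneInterpolationSpaces X Y := by
  refine ⟨⟨Embeds.refl _, (inter_embeds_left _ _).trans (embeds_sum_left _ _)⟩, 1, one_pos,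
    fun T _ => ?_⟩
  have hz : ∀ z : h.inter.carrier, (T.left ⟨z, z.2.1⟩ : E) = T.right ⟨z, z.2.2⟩ := fun z => by
    rw [← T.isRestriction_left ⟨z, (embeds_sum_left _ _).le z.2.1⟩ ⟨z, z.2.1⟩ rfl,
      ← T.isRestriction_right ⟨z, (embeds_sum_left _ _).le z.2.1⟩ ⟨z, z.2.2⟩ rfl]
  let S : h.inter.carrier →ₗ[𝕜] h.inter.carrier :=
    LinearMap.codRestrict h.inter.carrier
      (X.carrier.subtype ∘ₗ T.left.toLinearMap ∘ₗ
        Submodule.inclusion (inf_le_left : X.carrier ⊓ Y.carrier ≤ X.carrier))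
      fun z => ⟨(T.left ⟨z, z.2.1⟩).2, by
        have := (T.right ⟨z, z.2.2⟩).2
        rwa [← hz z] at this⟩
  have hS : ∀ z : h.inter.carrier, (S z : E) = T.left ⟨z, z.2.1⟩ := fun _ => rfl
  have hb : ∀ z : h.inter.carrier, ‖S z‖ ≤ T.opNorm * ‖z‖ := by
    intro z
    have h1 : ‖S z‖ = _ := (normOf_coe (X.inter Y.toSeminormedSubspace) (S z)).symm
    have h2 : ‖z‖ = _ := (normOf_coe (X.inter Y.toSeminormedSubspace) z).symm
    rw [h1, h2, normOf_inter _ _ (S z).2.1 (S z).2.2, normOf_inter _ _ z.2.1 z.2.2]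
    refine max_le ?_ ?_
    · rw [hS]
      exact (T.normOf_left_le z.2.1).trans
        (mul_le_mul_of_nonneg_left (le_max_left _ _) T.opNorm_nonneg)
    · rw [hS, hz]
      exact (T.normOf_right_le z.2.2).trans
        (mul_le_mul_of_nonneg_left (le_max_right _ _) T.opNorm_nonneg)
  refine ⟨S.mkContinuous _ hb, fun s z hsz => ?_, ?_⟩
  · have h1 : (S.mkContinuous _ hb z : E) = T.left ⟨z, z.2.1⟩ := rfl
    rw [h1, T.isRestriction_left s ⟨z, z.2.1⟩ hsz]
  · rw [one_mul]
    exact S.mkContinuous_norm_le T.opNorm_nonneg _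

/-- The test of a rank one interpolation space `Z` against the operator `z ↦ f z • u`. -/
theorem exists_smul_operator {X Y Z : BanachSubspace 𝕜 E} {C : ℝ}
    (hC : ∀ T : CoupleOperator X Y, T.IsRankOne →
      ∃ S : Z.carrier →L[𝕜] Z.carrier, IsRestriction T.toLinearMap Z S ∧ ‖S‖ ≤ C * T.opNorm)
    (hZ : Z.carrier ≤ X.carrier ⊔ Y.carrier)
    (f : ↥(X.carrier ⊔ Y.carrier) →ₗ[𝕜] 𝕜) (u : ↥(X.carrier ⊔ Y.carrier)) (hf : f ≠ 0)
    (hu : u ≠ 0) (fX : X.carrier →L[𝕜] 𝕜) (uX : X.carrier) (fY : Y.carrier →L[𝕜] 𝕜)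
    (uY : Y.carrier)
    (hX : ∀ (s : ↥(X.carrier ⊔ Y.carrier)) (x : X.carrier), (s : E) = x →
      f s • (u : E) = fX x • (uX : E))
    (hY : ∀ (s : ↥(X.carrier ⊔ Y.carrier)) (y : Y.carrier), (s : E) = y →
      f s • (u : E) = fY y • (uY : E)) :
    ∃ S : Z.carrier →L[𝕜] Z.carrier,
      (∀ z : Z.carrier, (S z : E) = f ⟨z, hZ z.2⟩ • (u : E)) ∧
      ‖S‖ ≤ C * max (‖fX‖ * ‖uX‖) (‖fY‖ * ‖uY‖) := by
  -- The restrictions to `X` and `Y` are given separately, so that if `f` vanishes on `Y` one may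
  -- take `uY = 0`, and `u` need not lie in `Y`.
  let T : CoupleOperator X Y :=
    { toLinearMap := f.smulRight u
      left := fX.smulRight uX
      right := fY.smulRight uY
      isRestriction_left := fun s x hs => by simpa using hX s x hs
      isRestriction_right := fun s y hs => by simpa using hY s y hs }
  have hrank : T.IsRankOne := by
    have hrange : LinearMap.range T.toLinearMap = Submodule.span 𝕜 {u} := by
      change LinearMap.range (f.smulRight u) = _
      rw [LinearMap.range_smulRight_apply hf]
    unfold CoupleOperator.IsRankOne
    rw [hrange, finrank_span_singleton hu]
  obtain ⟨S, hS, hSC⟩ := hC T hrank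
  refine ⟨S, fun z => ?_, ?_⟩
  · rw [← hS ⟨z, hZ z.2⟩ z rfl]
    rfl
  · have : T.opNorm = max (‖fX‖ * ‖uX‖) (‖fY‖ * ‖uY‖) := by
      change max ‖fX.smulRight uX‖ ‖fY.smulRight uY‖ = _
      rw [ContinuousLinearMap.norm_smulRight_apply, ContinuousLinearMap.norm_smulRight_apply]
    rwa [this] at hSC

/-- The rank one test for functionals on `X + Y` and elements of `X ∩ Y`. -/
theorem exists_norm_restrict_mul_normOf_le {X Y Z : BanachSubspace 𝕜 E}
    (hZ : Z ∈ rankOneInterpolationSpaces X Y) :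
    ∃ C > 0, ∀ (f : (X.sum Y.toSeminormedSubspace).carrier →L[𝕜] 𝕜),
      ∀ u ∈ X.carrier ⊓ Y.carrier,
        ‖hZ.1.2.restrict f‖ * Z.normOf u ≤
          C * max (‖(embeds_sum_left _ _).restrict f‖ * X.normOf u)
            (‖(embeds_sum_right _ _).restrict f‖ * Y.normOf u) := by
  obtain ⟨C, hC, hT⟩ := hZ.2
  refine ⟨C, hC, fun f u hu => ?_⟩
  set fX := (embeds_sum_left X.toSeminormedSubspace Y.toSeminormedSubspace).restrict f with hfX
  set fY := (embeds_sum_right X.toSeminormedSubspace Y.toSeminormedSubspace).restrict f with hfY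
  have hmax : 0 ≤ C * max (‖fX‖ * X.normOf u) (‖fY‖ * Y.normOf u) :=
    mul_nonneg hC.le (le_max_of_le_left (mul_nonneg (norm_nonneg _) (normOf_nonneg _ _)))
  have hZu : u ∈ Z.carrier := hZ.1.1.le hu
  -- If `f` or `u` is zero, the operator has rank zero and cannot be tested, but the estimate is
  -- trivial.
  by_cases hf : f = 0
  · have : hZ.1.2.restrict f = 0 := by
      rw [hf]; exact ContinuousLinearMap.zero_comp _
    rw [this, norm_zero, zero_mul]
    exact hmax
  by_cases hu0 : u = 0
  · rw [hu0, normOf_zero, mul_zero, ← hu0]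
    exact hmax
  obtain ⟨S, hS, hSC⟩ := exists_smul_operator hT hZ.1.2.le f.toLinearMap
    ⟨u, (embeds_sum_left _ _).le hu.1⟩
    (fun h0 => hf (ContinuousLinearMap.ext fun z => LinearMap.congr_fun h0 z))
    (fun h0 => hu0 (congrArg Subtype.val h0)) fX ⟨u, hu.1⟩ fY ⟨u, hu.2⟩
    (fun s x hs => by rw [hfX, Embeds.restrict_apply _ f x hs]; rfl)
    (fun s y hs => by rw [hfY, Embeds.restrict_apply _ f y hs]; rfl)
  rw [normOf_mk, normOf_mk] at hSC
  have hS' : S = (hZ.1.2.restrict f).smulRight ⟨u, hZu⟩ := by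
    ext z
    rw [hS z]
    change _ = (hZ.1.2.restrict f z) • u
    rw [hZ.1.2.restrict_apply f z (s := ⟨z, hZ.1.2.le z.2⟩) rfl]
    rfl
  rw [hS', ContinuousLinearMap.norm_smulRight_apply, normOf_mk] at hSC
  exact hSC

end BanachSubspace

/-! ### Comparison of norms on a subspace, closures, and dual norms -/

namespace SeminormedSubspace

variable {𝕜 E : Type*} [RCLike 𝕜] [AddCommGroup E] [Module 𝕜 E]

/-- On the subspace `D`, the norm of `A` is at most a constant times that of `B`. -/
def DominatedOn (D : Submodule 𝕜 E) (A B : SeminormedSubspace 𝕜 E) : Prop :=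
  ∃ C > 0, ∀ u ∈ D, A.normOf u ≤ C * B.normOf u

theorem DominatedOn.refl (D : Submodule 𝕜 E) (A : SeminormedSubspace 𝕜 E) : DominatedOn D A A :=
  ⟨1, one_pos, fun _ _ => (one_mul _).ge⟩

theorem DominatedOn.trans {D : Submodule 𝕜 E} {A B C : SeminormedSubspace 𝕜 E}
    (h : DominatedOn D A B) (h' : DominatedOn D B C) : DominatedOn D A C := by
  obtain ⟨c, hc, hAB⟩ := h
  obtain ⟨d, hd, hBC⟩ := h'
  refine ⟨c * d, mul_pos hc hd, fun u hu => (hAB u hu).trans ?_⟩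
  rw [mul_assoc]
  exact mul_le_mul_of_nonneg_left (hBC u hu) hc.le

/-- The norm of the intersection is the maximum of the two norms, so an upper bound for the norms of
one couple is one for the other. -/
theorem DominatedOn.of_inter_embeds {V W X Y B : SeminormedSubspace 𝕜 E}
    (h : (X.inter Y).Embeds (V.inter W)) {D : Submodule 𝕜 E} (hD : D ≤ X.carrier ⊓ Y.carrier)
    (hX : DominatedOn D X B) (hY : DominatedOn D Y B) :
    DominatedOn D V B ∧ DominatedOn D W B := by
  obtain ⟨C, hC, hb⟩ := h.exists_bound
  obtain ⟨c, hc, hXB⟩ := hX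
  obtain ⟨d, hd, hYB⟩ := hY
  have key : ∀ u ∈ D, max (V.normOf u) (W.normOf u) ≤ C * max c d * B.normOf u := by
    intro u hu
    have h1 := hb u (hD hu)
    rw [normOf_inter _ _ (hD hu).1 (hD hu).2,
      normOf_inter _ _ (h.le (hD hu)).1 (h.le (hD hu)).2] at h1
    refine h1.trans ?_
    rw [mul_assoc]
    refine mul_le_mul_of_nonneg_left (max_le ?_ ?_) hC.le
    · exact (hXB u hu).trans (mul_le_mul_of_nonneg_right (le_max_left _ _) (normOf_nonneg _ _))
    · exact (hYB u hu).trans (mul_le_mul_of_nonneg_right (le_max_right _ _) (normOf_nonneg _ _))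
  have hpos : 0 < C * max c d := mul_pos hC (lt_max_of_lt_left hc)
  exact ⟨⟨_, hpos, fun u hu => (le_max_left _ _).trans (key u hu)⟩,
    ⟨_, hpos, fun u hu => (le_max_right _ _).trans (key u hu)⟩⟩

/-- The closure of the subspace `D` in `X`, for the norm of `X`. -/
noncomputable def closureIn (X : SeminormedSubspace 𝕜 E) (D : Submodule 𝕜 E) : Submodule 𝕜 E :=
  (D.comap X.carrier.subtype).topologicalClosure.map X.carrier.subtype

theorem closureIn_le (X : SeminormedSubspace 𝕜 E) (D : Submodule 𝕜 E) :
    X.closureIn D ≤ X.carrier :=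
  Submodule.map_subtype_le _ _

theorem le_closureIn (X : SeminormedSubspace 𝕜 E) {D : Submodule 𝕜 E} (hD : D ≤ X.carrier) :
    D ≤ X.closureIn D := fun u hu =>
  ⟨⟨u, hD hu⟩, Submodule.le_topologicalClosure _ hu, rfl⟩

theorem Embeds.exists_norm_restrict_le {Z S : SeminormedSubspace 𝕜 E} (h : Z.Embeds S) :
    ∃ C > 0, ∀ f : S.carrier →L[𝕜] 𝕜, ‖h.restrict f‖ ≤ C * ‖f‖ := by
  refine ⟨‖h.choose‖ + 1, by positivity, fun f => ?_⟩
  refine (f.opNorm_comp_le h.choose).trans ?_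
  rw [mul_comm]
  gcongr
  linarith

/-- The dual norm of a sum is the maximum of the dual norms: every functional attains its size, up
to a constant, on `V` or on `W`. -/
theorem exists_norm_le_max_norm_restrict {V W S : SeminormedSubspace 𝕜 E} (hV : V.Embeds S)
    (hW : W.Embeds S) (hS : S.Embeds (V.sum W)) :
    ∃ C > 0, ∀ f : S.carrier →L[𝕜] 𝕜, ‖f‖ ≤ C * max ‖hV.restrict f‖ ‖hW.restrict f‖ := by
  obtain ⟨C, hC, hb⟩ := hS.exists_bound
  refine ⟨C, hC, fun f => f.opNorm_le_bound (by positivity) fun s => ?_⟩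
  set M := max ‖hV.restrict f‖ ‖hW.restrict f‖ with hM
  have hM0 : 0 ≤ M := (norm_nonneg _).trans (le_max_left _ _)
  have h1 : ‖f s‖ ≤ M * (V.sum W).normOf s := by
    refine le_of_forall_pos_le_add fun ε hε => ?_
    have hδ : 0 < ε / (M + 1) := by positivity
    obtain ⟨v, hv, w, hw, hvw, hlt⟩ := exists_lt_normOf_sum V W (hS.le s.2) hδ
    have hs : s = ⟨v, hV.le hv⟩ + ⟨w, hW.le hw⟩ := Subtype.ext hvw
    have h2 := hV.norm_apply_le f ⟨v, hV.le hv⟩ hv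
    have h3 := hW.norm_apply_le f ⟨w, hW.le hw⟩ hw
    have h4 : ‖f s‖ ≤ ‖f ⟨v, hV.le hv⟩‖ + ‖f ⟨w, hW.le hw⟩‖ := by
      conv_lhs => rw [hs, map_add]
      exact norm_add_le _ _
    have h5 := mul_le_mul_of_nonneg_right (le_max_left ‖hV.restrict f‖ ‖hW.restrict f‖)
      (V.normOf_nonneg v)
    have h6 := mul_le_mul_of_nonneg_right (le_max_right ‖hV.restrict f‖ ‖hW.restrict f‖)
      (W.normOf_nonneg w)
    rw [← hM] at h5 h6
    have h7 : M * (ε / (M + 1)) ≤ ε := by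
      rw [mul_div_assoc', div_le_iff₀ (by positivity)]
      nlinarith
    have h8 := mul_le_mul_of_nonneg_left hlt.le hM0
    simp only at h2 h3
    linarith
  refine h1.trans ?_
  have h2 := mul_le_mul_of_nonneg_left (hb s s.2) hM0
  rw [normOf_coe S] at h2
  linarith

end SeminormedSubspace

/-! ### Consequences of the rank one test -/

namespace BanachSubspace

variable {𝕜 E : Type*} [RCLike 𝕜] [AddCommGroup E] [Module 𝕜 E]

open SeminormedSubspace

/-- A sequence in `D` that is Cauchy for `B` is Cauchy for `A`, and its two limits agree in `S`. -/
theorem closureIn_le_closureIn {A B S : BanachSubspace 𝕜 E} {D : Submodule 𝕜 E}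
    (hA : A.Embeds S.toSeminormedSubspace) (hB : B.Embeds S.toSeminormedSubspace)
    (hDA : D ≤ A.carrier) (h : DominatedOn D A.toSeminormedSubspace B.toSeminormedSubspace) :
    B.closureIn D ≤ A.closureIn D := by
  rintro _ ⟨b, hb, rfl⟩
  obtain ⟨C, hC, hCb⟩ := h
  obtain ⟨u, hu, hub⟩ := mem_closure_iff_seq_limit.1 hb
  have huD : ∀ n, (u n : E) ∈ D := hu
  let a : ℕ → A.carrier := fun n => ⟨u n, hDA (huD n)⟩
  have ha : CauchySeq a := by
    rw [Metric.cauchySeq_iff']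
    intro ε hε
    obtain ⟨N, hN⟩ := Metric.cauchySeq_iff'.1 hub.cauchySeq (ε / C) (by positivity)
    refine ⟨N, fun n hn => ?_⟩
    have h1 := hN n hn
    have h2 := hCb _ (D.sub_mem (huD n) (huD N))
    rw [dist_eq_norm, ← normOf_coe] at h1 ⊢
    rw [lt_div_iff₀ hC, mul_comm] at h1
    exact h2.trans_lt h1
  obtain ⟨a₀, ha₀⟩ := cauchySeq_tendsto_of_complete ha
  obtain ⟨i, hi⟩ := hA
  obtain ⟨j, hj⟩ := hB
  have h1 := (i.continuous.tendsto _).comp ha₀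
  have h2 := (j.continuous.tendsto _).comp hub
  have h3 : i a₀ = j b := by
    refine tendsto_nhds_unique h1 (h2.congr fun n => Subtype.ext ?_)
    simp [hi, hj, a]
  have h4 := congrArg Subtype.val h3
  rw [hi, hj] at h4
  exact ⟨a₀, mem_closure_iff_seq_limit.2 ⟨a, huD, ha₀⟩, h4⟩

/-- A space which norms the functionals on a larger one is not smaller. -/
theorem le_of_norm_le_norm_restrict {W S : BanachSubspace 𝕜 E}
    (hW : W.Embeds S.toSeminormedSubspace) {K : ℝ} (hK0 : 0 ≤ K)
    (hK : ∀ f : S.carrier →L[𝕜] 𝕜, ‖f‖ ≤ K * ‖hW.restrict f‖) : S.carrier ≤ W.carrier := by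
  intro s hs
  obtain ⟨w, hw⟩ := ContinuousLinearMap.surjective_of_norm_le_norm_comp hW.choose hK0 hK ⟨s, hs⟩
  have h1 := hW.choose_spec w
  rw [hw] at h1
  have h2 : s = w := h1
  rw [h2]
  exact w.2

/-- As `Y` is not the whole sum, there are functionals with arbitrarily small norm on `Y` relative
to `‖f‖`. For these the `X` term of the test prevails, while `‖f‖` is attained up to a constant on
`V` or `W`; cancelling it leaves a bound by `‖u‖_X`. -/
theorem dominatedOn_left_of_not_le {X Y V W : BanachSubspace 𝕜 E} (hXY : IsCouple X Y)
    (hV : V ∈ rankOneInterpolationSpaces X Y) (hW : W ∈ rankOneInterpolationSpaces X Y)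
    (hsum : (X.sum Y.toSeminormedSubspace).Embeds (V.sum W.toSeminormedSubspace))
    (hle : ¬ X.carrier ≤ Y.carrier) :
    DominatedOn (X.carrier ⊓ Y.carrier) V.toSeminormedSubspace X.toSeminormedSubspace ∨
      DominatedOn (X.carrier ⊓ Y.carrier) W.toSeminormedSubspace X.toSeminormedSubspace := by
  by_contra! hcon
  obtain ⟨hnV, hnW⟩ := hcon
  obtain ⟨C, hC, hCV⟩ := exists_norm_restrict_mul_normOf_le hV
  obtain ⟨C', hC', hCW⟩ := exists_norm_restrict_mul_normOf_le hW
  obtain ⟨D, hD, hDf⟩ := exists_norm_le_max_norm_restrict hV.1.2 hW.1.2 hsum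
  obtain ⟨c, hc, hcf⟩ :=
    (embeds_sum_left X.toSeminormedSubspace Y.toSeminormedSubspace).exists_norm_restrict_le
  have hex : ∀ K ≥ 0, ∃ f : (X.sum Y.toSeminormedSubspace).carrier →L[𝕜] 𝕜,
      K * ‖(embeds_sum_right X.toSeminormedSubspace Y.toSeminormedSubspace).restrict f‖ < ‖f‖ := by
    intro K hK
    by_contra! h
    exact hle ((embeds_sum_left _ _).le.trans
      (le_of_norm_le_norm_restrict (S := hXY.sum) (W := Y) (embeds_sum_right _ _) hK h))
  have aux : ∀ (Z : BanachSubspace 𝕜 E) (C : ℝ), 0 < C →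
      ¬ DominatedOn (X.carrier ⊓ Y.carrier) Z.toSeminormedSubspace X.toSeminormedSubspace →
      ∃ u ∈ X.carrier ⊓ Y.carrier, ∃ K ≥ 0,
        0 < Z.normOf u ∧ D * C * c * X.normOf u < Z.normOf u ∧
        D * C * Y.normOf u < K * Z.normOf u := by
    intro Z C hC hn
    unfold DominatedOn at hn
    push Not at hn
    obtain ⟨u, hu, hlt⟩ := hn (D * C * c) (by positivity)
    have hpos : 0 < Z.normOf u :=
      (mul_nonneg (by positivity) (X.normOf_nonneg u)).trans_lt hlt
    refine ⟨u, hu, D * C * Y.normOf u / Z.normOf u + 1, ?_, hpos, hlt, ?_⟩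
    · have := Y.normOf_nonneg u
      positivity
    · rw [add_mul, div_mul_cancel₀ _ hpos.ne']
      linarith
  have fin : ∀ (a b x y z C K n : ℝ), 0 < C → 0 < n → 0 ≤ x → 0 ≤ y → 0 < z → 0 ≤ b →
      ∀ r : ℝ, r * z ≤ C * max (a * x) (b * y) → n ≤ D * r → a ≤ c * n → K * b < n →
      D * C * c * x < z → D * C * y < K * z → False := by
    intro a b x y z C K n hC hn hx hy hz hb r h1 h2 h3 h4 h5 h6
    have h7 : n * z ≤ D * (C * max (a * x) (b * y)) :=
      calc n * z ≤ D * r * z := by gcongr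
        _ = D * (r * z) := by ring
        _ ≤ _ := by gcongr
    rcases max_choice (a * x) (b * y) with hm | hm <;> rw [hm] at h7
    · have h8 : D * (C * (a * x)) ≤ D * (C * (c * n * x)) := by gcongr
      have h9 := mul_lt_mul_of_pos_left h5 hn
      linarith
    · rcases hb.eq_or_lt with rfl | hb'
      · nlinarith [mul_pos hn hz]
      · have h8 := mul_lt_mul_of_pos_right h6 hb'
        have h9 := mul_lt_mul_of_pos_right h4 hz
        linarith
  obtain ⟨u, hu, K, hK0, hpos, hux, huy⟩ := aux V C hC hnV
  obtain ⟨u', hu', K', hK0', hpos', hux', huy'⟩ := aux W C' hC' hnW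
  -- Whether `V` or `W` norms `f` is known only after `f` is chosen, so `f` must serve both `u` and
  -- `u'`.
  obtain ⟨f, hf⟩ := hex (K + K') (by positivity)
  set b := ‖(embeds_sum_right X.toSeminormedSubspace Y.toSeminormedSubspace).restrict f‖
  have hb : 0 ≤ b := norm_nonneg _
  have hKb := mul_nonneg hK0 hb
  have hKb' := mul_nonneg hK0' hb
  have hn : 0 < ‖f‖ := by linarith
  rcases max_choice ‖hV.1.2.restrict f‖ ‖hW.1.2.restrict f‖ with hm | hm
  · exact fin _ _ _ _ _ C K _ hC hn (X.normOf_nonneg u) (Y.normOf_nonneg u) hpos hb _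
      (hCV f u hu) (hm ▸ hDf f) (hcf f) (by linarith) hux huy
  · exact fin _ _ _ _ _ C' K' _ hC' hn (X.normOf_nonneg u') (Y.normOf_nonneg u') hpos' hb _
      (hCW f u' hu') (hm ▸ hDf f) (hcf f) (by linarith) hux' huy'

/-- Dual to `dominatedOn_left_of_not_le`, with vectors and functionals exchanged: vectors `u` with
`‖u‖_Y` small relative to `‖u‖_X` make the `X` term prevail, and `‖u‖_X` is controlled by the norm
of `u` in `V` or in `W`. -/
theorem exists_norm_restrict_le_of_not_dominatedOn {X Y V W : BanachSubspace 𝕜 E}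
    (hV : V ∈ rankOneInterpolationSpaces X Y) (hW : W ∈ rankOneInterpolationSpaces X Y)
    (hVW : (V.inter W.toSeminormedSubspace).Embeds (X.inter Y.toSeminormedSubspace))
    (hn : ¬ DominatedOn (X.carrier ⊓ Y.carrier) X.toSeminormedSubspace Y.toSeminormedSubspace) :
    (∃ K ≥ 0, ∀ f, ‖hV.1.2.restrict f‖ ≤ K * ‖(embeds_sum_left _ _).restrict f‖) ∨
      ∃ K ≥ 0, ∀ f, ‖hW.1.2.restrict f‖ ≤ K * ‖(embeds_sum_left _ _).restrict f‖ := by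
  by_contra! hcon
  obtain ⟨hnV, hnW⟩ := hcon
  obtain ⟨C, hC, hCV⟩ := exists_norm_restrict_mul_normOf_le hV
  obtain ⟨C', hC', hCW⟩ := exists_norm_restrict_mul_normOf_le hW
  obtain ⟨D, hD, hDu⟩ := hVW.exists_bound
  obtain ⟨f, hf⟩ := hnV (D * C) (by positivity)
  obtain ⟨f', hf'⟩ := hnW (D * C') (by positivity)
  have fin : ∀ (a b x y r C K : ℝ), 0 < C → 0 ≤ a → 0 ≤ b → 0 < x → 0 ≤ y →
      ∀ v : ℝ, r * v ≤ C * max (a * x) (b * y) → x ≤ D * v → K * y < x →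
      D * C * a < r → D * C * b < K * r → False := by
    intro a b x y r C K hC ha hb hx hy v h1 h2 h3 h4 h5
    have hr : 0 < r := (by positivity : 0 ≤ D * C * a).trans_lt h4
    have h7 : r * x ≤ D * (C * max (a * x) (b * y)) :=
      calc r * x ≤ r * (D * v) := by gcongr
        _ = D * (r * v) := by ring
        _ ≤ _ := by gcongr
    rcases max_choice (a * x) (b * y) with hm | hm <;> rw [hm] at h7
    · have h8 := mul_lt_mul_of_pos_right h4 hx
      linarith
    · have h8 := mul_le_mul_of_nonneg_right h5.le hy
      have h9 := mul_lt_mul_of_pos_left h3 hr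
      linarith
  have aux : ∀ b r C : ℝ, 0 < r → 0 < C → 0 ≤ b → ∃ K ≥ 0, D * C * b < K * r := by
    intro b r C hr hC hb
    refine ⟨D * C * b / r + 1, by positivity, ?_⟩
    rw [add_mul, div_mul_cancel₀ _ hr.ne']
    linarith
  have hposr : ∀ a r C : ℝ, 0 ≤ a → 0 < C → D * C * a < r → 0 < r := fun a r C ha hC h =>
    (by positivity : 0 ≤ D * C * a).trans_lt h
  obtain ⟨K, hK0, hK⟩ := aux _ _ C (hposr _ _ C (norm_nonneg _) hC hf) hC
    (norm_nonneg ((embeds_sum_right X.toSeminormedSubspace Y.toSeminormedSubspace).restrict f))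
  obtain ⟨K', hK0', hK'⟩ := aux _ _ C' (hposr _ _ C' (norm_nonneg _) hC' hf') hC'
    (norm_nonneg ((embeds_sum_right X.toSeminormedSubspace Y.toSeminormedSubspace).restrict f'))
  unfold DominatedOn at hn
  push Not at hn
  obtain ⟨u, hu, hlt⟩ := hn (K + K' + 1) (by positivity)
  have hy := Y.normOf_nonneg u
  have hKy := mul_nonneg hK0 hy
  have hKy' := mul_nonneg hK0' hy
  have hx : 0 < X.normOf u := by linarith
  have hmax : X.normOf u ≤ D * max (V.normOf u) (W.normOf u) := by
    have h1 := hDu u ⟨hV.1.1.le hu, hW.1.1.le hu⟩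
    rw [normOf_inter _ _ hu.1 hu.2, normOf_inter _ _ (hV.1.1.le hu) (hW.1.1.le hu)] at h1
    exact (le_max_left _ _).trans h1
  rcases max_choice (V.normOf u) (W.normOf u) with hm | hm <;> rw [hm] at hmax
  · exact fin _ _ _ _ _ C K hC (norm_nonneg _) (norm_nonneg _) hx hy _ (hCV f u hu) hmax
      (by linarith) hf hK
  · exact fin _ _ _ _ _ C' K' hC' (norm_nonneg _) (norm_nonneg _) hx hy _ (hCW f' u hu) hmax
      (by linarith) hf' hK'

/-- The rank one test for functionals which vanish on `Y`. -/
theorem le_or_le_sup_closureIn {X Y V : BanachSubspace 𝕜 E}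
    (hV : V ∈ rankOneInterpolationSpaces X Y) :
    X.carrier ≤ V.carrier ∨
      V.carrier ≤ Y.carrier ⊔ X.closureIn (X.carrier ⊓ Y.carrier) := by
  by_contra! hcon
  obtain ⟨h1, h2⟩ := hcon
  obtain ⟨u, huX, huV⟩ := SetLike.not_le_iff_exists.1 h1
  obtain ⟨v, hvV, hv⟩ := SetLike.not_le_iff_exists.1 h2
  obtain ⟨x, hx, y, hy, rfl⟩ := Submodule.mem_sup.1 (hV.1.2.le hvV)
  have hxcl : (⟨x, hx⟩ : X.carrier) ∉
      ((X.carrier ⊓ Y.carrier).comap X.carrier.subtype).topologicalClosure := by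
    intro h
    apply hv
    rw [add_comm]
    exact Submodule.add_mem_sup hy ⟨_, h, rfl⟩
  obtain ⟨g, hg, hgx⟩ :=
    Submodule.exists_continuousLinearMap_ne_zero_of_notMem_topologicalClosure _ hxcl
  have hcompat : ∀ (a : X.carrier) (b : Y.carrier), (a : E) = b →
      g a = (0 : Y.carrier →ₗ[𝕜] 𝕜) b := fun a b hab => by
    rw [hg a ⟨a.2, by change (a : E) ∈ Y.carrier; rw [hab]; exact b.2⟩, LinearMap.zero_apply]
  -- Since `g` vanishes on `X ∩ Y`, it glues with zero on `Y` to a functional `f` on the sum. The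
  -- operator `f ⊗ u` sends `x + y` in `V` to `g x • u`, which forces `u` into `V`.
  let P : E →ₗ.[𝕜] 𝕜 := ⟨X.carrier, g.toLinearMap⟩
  let Q : E →ₗ.[𝕜] 𝕜 := ⟨Y.carrier, 0⟩
  let f : ↥(X.carrier ⊔ Y.carrier) →ₗ[𝕜] 𝕜 := (P.sup Q hcompat).toFun
  have hf : ∀ (a : X.carrier) (b : Y.carrier) (s : ↥(X.carrier ⊔ Y.carrier)),
      (a : E) + b = s → f s = g a := fun a b s hs => by
    have := LinearPMap.sup_apply (f := P) (g := Q) hcompat a b s hs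
    exact this.trans (add_zero _)
  have hfv := hf ⟨x, hx⟩ ⟨y, hy⟩ ⟨x + y, hV.1.2.le hvV⟩ rfl
  obtain ⟨C, hC, hT⟩ := hV.2
  obtain ⟨S, hS, -⟩ := exists_smul_operator hT hV.1.2.le f ⟨u, (embeds_sum_left _ _).le huX⟩
    (fun h0 => hgx (by rw [← hfv, h0, LinearMap.zero_apply]))
    (fun h0 => huV (by
      have : u = 0 := congrArg Subtype.val h0
      rw [this]
      exact V.carrier.zero_mem))
    g ⟨u, huX⟩ 0 0
    (fun s a hs => by rw [hf a 0 s (by simp [hs])])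
    (fun s b hs => by rw [hf 0 b s (by simp [hs])]; simp)
  have hSv := (S ⟨x + y, hvV⟩).2
  rw [hS, hfv] at hSv
  exact huV ((V.carrier.smul_mem_iff hgx).1 hSv)

end BanachSubspace

/-! ### Modular lattices and matching of pairs -/

theorem eq_of_inf_eq_inf_of_sup_eq_sup {α : Type*} [Lattice α] [IsModularLattice α]
    {x y v w : α} (hi : x ⊓ y = v ⊓ w) (hs : x ⊔ y = v ⊔ w) (hx : x ≤ v) (hy : y ≤ w) :
    x = v ∧ y = w := by
  have key : ∀ {x y v w : α}, x ⊓ y = v ⊓ w → x ⊔ y = v ⊔ w → x ≤ v → y ≤ w → x = v := by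
    intro x y v w hi hs hx hy
    refine le_antisymm hx ?_
    calc v ≤ (x ⊔ y) ⊓ v := le_inf (hs ▸ le_sup_left) le_rfl
      _ = x ⊔ y ⊓ v := sup_inf_assoc_of_le _ hx
      _ ≤ x := sup_le le_rfl (by
        have h : y ⊓ v ≤ x ⊓ y := hi ▸ le_inf inf_le_right (inf_le_left.trans hy)
        exact h.trans inf_le_left)
  exact ⟨key hi hs hx hy, key (by rwa [inf_comm y, inf_comm w]) (by rwa [sup_comm y, sup_comm w])
    hy hx⟩

/-- If `y ⊓ b ≤ a ≤ b`, then an element of `[a, b]` below `y ⊔ a` is equal to `a`. -/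
theorem le_of_le_sup_of_inf_le {α : Type*} [Lattice α] [IsModularLattice α] {a b y : α}
    (hab : a ≤ b) (hb : b ≤ y ⊔ a) (hy : y ⊓ b ≤ a) : b ≤ a :=
  calc b ≤ (a ⊔ y) ⊓ b := le_inf (hb.trans_eq (sup_comm _ _)) le_rfl
    _ = a ⊔ y ⊓ b := sup_inf_assoc_of_le _ hab
    _ ≤ a := sup_le le_rfl hy

/-- Unless `y ≤ w`, modularity pushes `w` below `y₀`. Then either `v ≤ x` and the pairs are
comparable the other way, or `y ≤ w ⊔ x₀ ≤ y₀ ⊔ x` pushes `y` below `y₀ ≤ w` after all. -/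
theorem eq_and_eq_of_le_of_le_sup {α : Type*} [Lattice α] [IsModularLattice α]
    {x y v w x₀ y₀ : α} (hi : x ⊓ y = v ⊓ w) (hs : x ⊔ y = v ⊔ w) (hx₀ : x₀ ≤ x)
    (hxy₀ : x ⊓ y ≤ y₀) (hy₀ : y₀ ≤ y) (hyw : y₀ ≤ w)
    (h4 : y ≤ w ∨ w ≤ x ⊔ y₀) (h2' : v ≤ y ∨ y ≤ w ⊔ x₀)
    (hxy : ¬ x ≤ y) (hxv : x ≤ v) : x = v ∧ y = w := by
  by_cases hyw' : y ≤ w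
  · exact eq_of_inf_eq_inf_of_sup_eq_sup hi hs hxv hyw'
  have hw : w ≤ y₀ := le_of_le_sup_of_inf_le hyw (h4.resolve_left hyw')
    ((inf_le_inf_right w hxv).trans (hi ▸ hxy₀))
  have hwy := hw.trans hy₀
  by_cases hvx : v ≤ x
  · have := eq_of_inf_eq_inf_of_sup_eq_sup hi.symm hs.symm hvx hwy
    exact ⟨this.1.symm, this.2.symm⟩
  have hyx : y ≤ w ⊔ x₀ := h2'.resolve_left fun hvy => hxy (hxv.trans hvy)
  refine absurd ?_ hyw'
  have : y ≤ y₀ := le_of_le_sup_of_inf_le (y := x) hy₀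
    (hyx.trans (sup_le (hw.trans le_sup_right) (hx₀.trans le_sup_left))) hxy₀
  exact this.trans hyw

/-- Any one of `x ≤ v`, `y ≤ w`, `v ≤ x`, `w ≤ y` gives the first matching, by
`eq_and_eq_of_le_of_le_sup` in one of its symmetric forms. If all fail, the remaining alternatives
force `x ≤ w` and `y ≤ v`, hence the second matching. -/
theorem eq_and_eq_or_eq_and_eq {α : Type*} [Lattice α] [IsModularLattice α]
    {x y v w x₀ y₀ : α} (hi : x ⊓ y = v ⊓ w) (hs : x ⊔ y = v ⊔ w) (hx₀ : x₀ ≤ x) (hy₀ : y₀ ≤ y)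
    (hxv : x₀ ≤ v) (hyw : y₀ ≤ w) (hxy₀ : x ⊓ y ≤ x₀ ⊓ y₀)
    (h1 : x ≤ v ∨ v ≤ y ⊔ x₀) (h2 : x ≤ w ∨ w ≤ y ⊔ x₀)
    (h3 : y ≤ v ∨ v ≤ x ⊔ y₀) (h4 : y ≤ w ∨ w ≤ x ⊔ y₀)
    (h1' : v ≤ x ∨ x ≤ w ⊔ x₀) (h2' : v ≤ y ∨ y ≤ w ⊔ x₀)
    (h3' : w ≤ x ∨ x ≤ v ⊔ y₀) (h4' : w ≤ y ∨ y ≤ v ⊔ y₀)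
    (hxy : ¬ x ≤ y) (hyx : ¬ y ≤ x) (hvw : ¬ v ≤ w) (hwv : ¬ w ≤ v) :
    (x = v ∧ y = w) ∨ (x = w ∧ y = v) := by
  have hx := hxy₀.trans inf_le_left
  have hy := hxy₀.trans inf_le_right
  have hi' : y ⊓ x = w ⊓ v := by rwa [inf_comm y, inf_comm w]
  have hs' : y ⊔ x = w ⊔ v := by rwa [sup_comm y, sup_comm w]
  by_cases c1 : x ≤ v
  · exact Or.inl (eq_and_eq_of_le_of_le_sup hi hs hx₀ hy hy₀ hyw h4 h2' hxy c1)
  by_cases c2 : y ≤ w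
  · exact Or.inl (eq_and_eq_of_le_of_le_sup hi' hs' hy₀ (inf_comm y x ▸ hx) hx₀ hxv h1 h3' hyx
      c2).symm
  by_cases c3 : v ≤ x
  · exact absurd (eq_and_eq_of_le_of_le_sup hi.symm hs.symm hxv (hi ▸ hy) hyw hy₀ h4' h2 hvw
      c3).1.ge c1
  by_cases c4 : w ≤ y
  · exact absurd (eq_and_eq_of_le_of_le_sup hi'.symm hs'.symm hyw
      (hi' ▸ inf_comm y x ▸ hx) hxv hx₀ h1' h3 hwv c4).1.ge c2
  have d1' := h1'.resolve_left c3
  have d4' := h4'.resolve_left c4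
  have hyv : y ≤ v := h3.resolve_right fun h => c2 <| le_trans (le_of_le_sup_of_inf_le hy₀
    (d4'.trans (sup_le h le_sup_right)) hy) hyw
  have hxw : x ≤ w := h2.resolve_right fun h => c1 <| le_trans (le_of_le_sup_of_inf_le hx₀
    (d1'.trans (sup_le h le_sup_right)) (inf_comm y x ▸ hx)) hxv
  exact Or.inr (eq_of_inf_eq_inf_of_sup_eq_sup (hi.trans (inf_comm _ _))
    (hs.trans (sup_comm _ _)) hxw hyv)

/-- In a preorder in which the pairs `x, y` and `v, w` have the same upper bounds, and each of the
four elements is above one of the other pair, the two pairs agree. -/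
theorem pairs_equivalent_of_upper_bounds {α : Type*} {R : α → α → Prop} {x y v w : α}
    (hr : ∀ a, R a a) (ht : ∀ {a b c}, R a b → R b c → R a c)
    (h1 : ∀ b, R v b → R w b → R x b ∧ R y b) (h2 : ∀ b, R x b → R y b → R v b ∧ R w b)
    (hx : R v x ∨ R w x) (hy : R v y ∨ R w y) (hv : R x v ∨ R y v) (hw : R x w ∨ R y w) :
    (R x v ∧ R v x ∧ R y w ∧ R w y) ∨ (R x w ∧ R w x ∧ R y v ∧ R v y) := by
  have h1x := h1 x
  have h1y := h1 y
  have h2v := h2 v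
  have h2w := h2 w
  have hrx := hr x
  have hry := hr y
  have hrv := hr v
  have hrw := hr w
  grind

theorem SeminormedSubspace.Embeds.exists_norm_restrict_le_norm_restrict {𝕜 E : Type*} [RCLike 𝕜]
    [AddCommGroup E] [Module 𝕜 E] {A B S : SeminormedSubspace 𝕜 E} (h : A.Embeds B)
    (hA : A.Embeds S) (hB : B.Embeds S) :
    ∃ C > 0, ∀ f : S.carrier →L[𝕜] 𝕜, ‖hA.restrict f‖ ≤ C * ‖hB.restrict f‖ := by
  obtain ⟨C, hC, hb⟩ := h.exists_bound
  refine ⟨C, hC, fun f => ContinuousLinearMap.opNorm_le_bound _ (by positivity) fun x => ?_⟩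
  rw [hA.restrict_apply f x (s := ⟨x, hA.le x.2⟩) rfl]
  refine (hB.norm_apply_le f _ (h.le x.2)).trans ?_
  have h1 := mul_le_mul_of_nonneg_left (hb x x.2) (norm_nonneg (hB.restrict f))
  rw [normOf_coe A] at h1
  exact h1.trans_eq (by ring)

/-! ### Two couples with the same rank one interpolation spaces -/

namespace BanachSubspace

variable {𝕜 E : Type*} [RCLike 𝕜] [AddCommGroup E] [Module 𝕜 E]

open SeminormedSubspace

theorem IsCouple.symm {X Y : BanachSubspace 𝕜 E} (h : IsCouple X Y) : IsCouple Y X := by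
  obtain ⟨τ, h1, h2, h3, hX, hY⟩ := h
  exact ⟨τ, h1, h2, h3, hY, hX⟩

theorem rankOneInterpolationSpaces_subset_swap (X Y : BanachSubspace 𝕜 E) :
    rankOneInterpolationSpaces X Y ⊆ rankOneInterpolationSpaces Y X := by
  rintro Z ⟨⟨h1, h2⟩, C, hC, hT⟩
  refine ⟨⟨(inter_embeds_inter_swap _ _).trans h1, h2.trans (sum_embeds_sum_swap _ _)⟩, C, hC,
    fun T hrank => ?_⟩
  let e : ↥(Y.carrier ⊔ X.carrier) ≃ₗ[𝕜] ↥(X.carrier ⊔ Y.carrier) :=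
    LinearEquiv.ofEq _ _ (sup_comm _ _)
  have he : ∀ s, (e s : E) = s := fun _ => rfl
  have he' : ∀ s, (e.symm s : E) = s := fun _ => rfl
  let T' : CoupleOperator X Y :=
    { toLinearMap := e.toLinearMap ∘ₗ T.toLinearMap ∘ₗ e.symm.toLinearMap
      left := T.right
      right := T.left
      isRestriction_left := fun s x hs => T.isRestriction_right (e.symm s) x hs
      isRestriction_right := fun s y hs => T.isRestriction_left (e.symm s) y hs }
  have hrank' : T'.IsRankOne := by
    have hrange : LinearMap.range T'.toLinearMap =
        (LinearMap.range T.toLinearMap).map e.toLinearMap := by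
      change LinearMap.range (e.toLinearMap ∘ₗ T.toLinearMap ∘ₗ e.symm.toLinearMap) = _
      rw [LinearMap.range_comp, LinearMap.range_comp_of_range_eq_top _ e.symm.range]
    unfold CoupleOperator.IsRankOne at hrank ⊢
    rw [hrange, LinearEquiv.finrank_map_eq, hrank]
  obtain ⟨S, hS, hSC⟩ := hT T' hrank'
  refine ⟨S, fun s z hs => hS (e s) z hs, hSC.trans_eq ?_⟩
  change C * max ‖T.right‖ ‖T.left‖ = C * max ‖T.left‖ ‖T.right‖
  rw [max_comm]

theorem rankOneInterpolationSpaces_swap (X Y : BanachSubspace 𝕜 E) :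
    rankOneInterpolationSpaces X Y = rankOneInterpolationSpaces Y X :=
  (rankOneInterpolationSpaces_subset_swap X Y).antisymm
    (rankOneInterpolationSpaces_subset_swap Y X)

/-- Two Banach couples with the same rank one interpolation spaces. -/
structure SameRankOneInterpolationSpaces (X Y V W : BanachSubspace 𝕜 E) : Prop where
  isCouple : IsCouple X Y
  isCouple' : IsCouple V W
  eq : rankOneInterpolationSpaces X Y = rankOneInterpolationSpaces V W

namespace SameRankOneInterpolationSpaces

variable {X Y V W : BanachSubspace 𝕜 E}

theorem symm (h : SameRankOneInterpolationSpaces X Y V W) :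
    SameRankOneInterpolationSpaces V W X Y :=
  ⟨h.isCouple', h.isCouple, h.eq.symm⟩

theorem swap (h : SameRankOneInterpolationSpaces X Y V W) :
    SameRankOneInterpolationSpaces Y X V W :=
  ⟨h.isCouple.symm, h.isCouple', (rankOneInterpolationSpaces_swap Y X).trans h.eq⟩

theorem swap' (h : SameRankOneInterpolationSpaces X Y V W) :
    SameRankOneInterpolationSpaces X Y W V :=
  h.symm.swap.symm

theorem mem (h : SameRankOneInterpolationSpaces X Y V W) :
    V ∈ rankOneInterpolationSpaces X Y :=
  h.eq ▸ left_mem_rankOneInterpolationSpaces V W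

theorem inter_embeds (h : SameRankOneInterpolationSpaces X Y V W) :
    (X.inter Y.toSeminormedSubspace).Embeds (V.inter W.toSeminormedSubspace) :=
  (h.eq ▸ h.isCouple'.inter_mem_rankOneInterpolationSpaces :
    h.isCouple'.inter ∈ rankOneInterpolationSpaces X Y).1.1

theorem sum_embeds (h : SameRankOneInterpolationSpaces X Y V W) :
    (X.sum Y.toSeminormedSubspace).Embeds (V.sum W.toSeminormedSubspace) :=
  (h.eq ▸ h.isCouple.sum_mem_rankOneInterpolationSpaces :
    h.isCouple.sum ∈ rankOneInterpolationSpaces V W).1.2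

theorem inf_eq (h : SameRankOneInterpolationSpaces X Y V W) :
    X.carrier ⊓ Y.carrier = V.carrier ⊓ W.carrier :=
  h.inter_embeds.le.antisymm h.symm.inter_embeds.le

theorem sup_eq (h : SameRankOneInterpolationSpaces X Y V W) :
    X.carrier ⊔ Y.carrier = V.carrier ⊔ W.carrier :=
  h.sum_embeds.le.antisymm h.symm.sum_embeds.le

theorem equivalent_of_eq (h : SameRankOneInterpolationSpaces X Y V W)
    (hXV : X.carrier = V.carrier) : X.Equivalent V.toSeminormedSubspace := by
  have hX : X.Embeds h.isCouple.sum.toSeminormedSubspace := embeds_sum_left _ _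
  have hV : V.Embeds h.isCouple.sum.toSeminormedSubspace := h.mem.1.2
  exact .of_embeds (embeds_of_le hX hV hXV.le) (embeds_of_le hV hX hXV.ge)

/-- Either `X` is closed in `Y`, and functionals on `Y` vanishing on `X` decide; or the norm of `X`
is not dominated by that of `Y`, and the dual comparison shows that `V` or `W` is the whole sum. -/
theorem le_or_le_of_le (h : SameRankOneInterpolationSpaces X Y V W)
    (hle : X.carrier ≤ Y.carrier) : V.carrier ≤ W.carrier ∨ W.carrier ≤ V.carrier := by
  have hX : X.Embeds h.isCouple.sum.toSeminormedSubspace := embeds_sum_left _ _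
  have hY : Y.Embeds h.isCouple.sum.toSeminormedSubspace := embeds_sum_right _ _
  have hXi : X.carrier ≤ V.carrier ⊓ W.carrier := h.inf_eq ▸ le_inf le_rfl hle
  have hYs : V.carrier ⊔ W.carrier ≤ Y.carrier := h.sup_eq ▸ sup_le hle le_rfl
  by_cases hdom : DominatedOn (X.carrier ⊓ Y.carrier) X.toSeminormedSubspace
      Y.toSeminormedSubspace
  · have hcl := closureIn_le_closureIn hX hY inf_le_left hdom
    rcases le_or_le_sup_closureIn h.swap.mem with hYV | hVX
    · exact Or.inr ((le_sup_right.trans hYs).trans hYV)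
    · rw [inf_comm] at hVX
      have hVX' : V.carrier ≤ X.carrier :=
        hVX.trans (sup_le le_rfl (hcl.trans (closureIn_le _ _)))
      exact Or.inl (hVX'.trans (hXi.trans inf_le_right))
  -- As `X ⊆ V ∩ W`, the assumption bounds the dual norm of `V` by that of `X`, hence by that of
  -- `W`. So `W` alone norms the functionals on the sum and equals it.
  · have key : ∀ {V W : BanachSubspace 𝕜 E} (h : SameRankOneInterpolationSpaces X Y V W),
        (∃ K ≥ 0, ∀ f, ‖h.mem.1.2.restrict f‖ ≤ K * ‖(embeds_sum_left _ _).restrict f‖) →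
        V.carrier ≤ W.carrier := by
      intro V W h ⟨K, hK0, hK⟩
      have hXW : X.Embeds W.toSeminormedSubspace := embeds_of_le hX (S := h.isCouple.sum)
        h.swap'.mem.1.2 ((h.inf_eq ▸ le_inf le_rfl hle :
          X.carrier ≤ V.carrier ⊓ W.carrier).trans inf_le_right)
      obtain ⟨C, hC, hXf⟩ := hXW.exists_norm_restrict_le_norm_restrict (embeds_sum_left _ _)
        h.swap'.mem.1.2
      obtain ⟨D, hD, hDf⟩ := exists_norm_le_max_norm_restrict h.mem.1.2 h.swap'.mem.1.2
        h.sum_embeds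
      refine h.mem.1.2.le.trans (le_of_norm_le_norm_restrict (S := h.isCouple.sum)
        h.swap'.mem.1.2 (K := D * max (K * C) 1) (by positivity) fun f => ?_)
      refine (hDf f).trans ?_
      rw [mul_assoc]
      refine mul_le_mul_of_nonneg_left (max_le ?_ ?_) hD.le
      · refine (hK f).trans ?_
        refine (mul_le_mul_of_nonneg_left (hXf f) hK0).trans ?_
        rw [← mul_assoc]
        exact mul_le_mul_of_nonneg_right (le_max_left _ _) (norm_nonneg _)
      · exact le_mul_of_one_le_left (norm_nonneg _) (le_max_right _ _)
    exact (exists_norm_restrict_le_of_not_dominatedOn h.mem h.swap'.mem h.symm.inter_embeds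
      hdom).imp (key h) (key h.swap')

theorem carrier_eq_of_le (h : SameRankOneInterpolationSpaces X Y V W)
    (hXY : X.carrier ≤ Y.carrier) (hVW : V.carrier ≤ W.carrier) :
    X.carrier = V.carrier ∧ Y.carrier = W.carrier := by
  have hi := h.inf_eq
  have hs := h.sup_eq
  rw [inf_eq_left.2 hXY, inf_eq_left.2 hVW] at hi
  rw [sup_eq_right.2 hXY, sup_eq_right.2 hVW] at hs
  exact ⟨hi, hs⟩

theorem carrier_eq_or_of_le (h : SameRankOneInterpolationSpaces X Y V W)
    (hXY : X.carrier ≤ Y.carrier) :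
    (X.carrier = V.carrier ∧ Y.carrier = W.carrier) ∨
      (X.carrier = W.carrier ∧ Y.carrier = V.carrier) :=
  (h.le_or_le_of_le hXY).imp (h.carrier_eq_of_le hXY) (h.swap'.carrier_eq_of_le hXY)

theorem carrier_eq_of_dominatedOn (h : SameRankOneInterpolationSpaces X Y V W)
    (hXY : ¬ X.carrier ≤ Y.carrier) (hYX : ¬ Y.carrier ≤ X.carrier)
    (hVW : ¬ V.carrier ≤ W.carrier) (hWV : ¬ W.carrier ≤ V.carrier)
    (h1 : DominatedOn (X.carrier ⊓ Y.carrier) X.toSeminormedSubspace V.toSeminormedSubspace)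
    (h2 : DominatedOn (X.carrier ⊓ Y.carrier) V.toSeminormedSubspace X.toSeminormedSubspace)
    (h3 : DominatedOn (X.carrier ⊓ Y.carrier) Y.toSeminormedSubspace W.toSeminormedSubspace)
    (h4 : DominatedOn (X.carrier ⊓ Y.carrier) W.toSeminormedSubspace Y.toSeminormedSubspace) :
    (X.carrier = V.carrier ∧ Y.carrier = W.carrier) ∨
      (X.carrier = W.carrier ∧ Y.carrier = V.carrier) := by
  have hX : X.Embeds h.isCouple.sum.toSeminormedSubspace := embeds_sum_left _ _
  have hY : Y.Embeds h.isCouple.sum.toSeminormedSubspace := embeds_sum_right _ _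
  have hV : V.Embeds h.isCouple.sum.toSeminormedSubspace := h.mem.1.2
  have hW : W.Embeds h.isCouple.sum.toSeminormedSubspace := h.swap'.mem.1.2
  set D := X.carrier ⊓ Y.carrier with hD
  have hDX : D ≤ X.carrier := inf_le_left
  have hDY : D ≤ Y.carrier := inf_le_right
  have hDVW : D = V.carrier ⊓ W.carrier := h.inf_eq
  have hDV : D ≤ V.carrier := hDVW.le.trans inf_le_left
  have hDW : D ≤ W.carrier := hDVW.le.trans inf_le_right
  have hXV : X.closureIn D = V.closureIn D :=
    (closureIn_le_closureIn hV hX hDV h2).antisymm (closureIn_le_closureIn hX hV hDX h1)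
  have hYW : Y.closureIn D = W.closureIn D :=
    (closureIn_le_closureIn hW hY hDW h4).antisymm (closureIn_le_closureIn hY hW hDY h3)
  have t : ∀ {X Y V W : BanachSubspace 𝕜 E} (h : SameRankOneInterpolationSpaces X Y V W)
      {D : Submodule 𝕜 E}, D = X.carrier ⊓ Y.carrier → X.carrier ≤ V.carrier ∨
        V.carrier ≤ Y.carrier ⊔ X.closureIn D := by
    rintro X Y V W h D rfl
    exact le_or_le_sup_closureIn h.mem
  have hD' : D = Y.carrier ⊓ X.carrier := inf_comm _ _
  have hDWV : D = W.carrier ⊓ V.carrier := hDVW.trans (inf_comm _ _)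
  refine eq_and_eq_or_eq_and_eq h.inf_eq h.sup_eq (closureIn_le _ D) (closureIn_le _ D)
    (hXV ▸ closureIn_le _ D) (hYW ▸ closureIn_le _ D)
    (le_inf (le_closureIn _ hDX) (le_closureIn _ hDY)) (t h hD) (t h.swap' hD) (t h.swap hD')
    (t h.swap'.swap hD') ?_ ?_ ?_ ?_ hXY hYX hVW hWV
  · exact hXV ▸ t h.symm hDVW
  · exact hXV ▸ t h.symm.swap' hDVW
  · exact hYW ▸ t h.symm.swap hDWV
  · exact hYW ▸ t h.symm.swap.swap' hDWV

theorem carrier_eq_or (h : SameRankOneInterpolationSpaces X Y V W) :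
    (X.carrier = V.carrier ∧ Y.carrier = W.carrier) ∨
      (X.carrier = W.carrier ∧ Y.carrier = V.carrier) := by
  by_cases hXY : X.carrier ≤ Y.carrier
  · exact h.carrier_eq_or_of_le hXY
  by_cases hYX : Y.carrier ≤ X.carrier
  · exact (h.swap.carrier_eq_or_of_le hYX).symm.imp And.symm And.symm
  by_cases hVW : V.carrier ≤ W.carrier
  · exact (h.symm.carrier_eq_or_of_le hVW).imp (fun e => ⟨e.1.symm, e.2.symm⟩)
      fun e => ⟨e.2.symm, e.1.symm⟩
  by_cases hWV : W.carrier ≤ V.carrier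
  · exact (h.swap'.symm.carrier_eq_or_of_le hWV).symm.imp (fun e => ⟨e.2.symm, e.1.symm⟩)
      fun e => ⟨e.1.symm, e.2.symm⟩
  have t : ∀ {X Y V W : BanachSubspace 𝕜 E} (h : SameRankOneInterpolationSpaces X Y V W)
      {D : Submodule 𝕜 E}, D = X.carrier ⊓ Y.carrier → ¬ X.carrier ≤ Y.carrier →
      DominatedOn D V.toSeminormedSubspace X.toSeminormedSubspace ∨
        DominatedOn D W.toSeminormedSubspace X.toSeminormedSubspace := by
    rintro X Y V W h D rfl hle
    exact dominatedOn_left_of_not_le h.isCouple h.mem h.swap'.mem h.sum_embeds hle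
  -- No inclusion holds within either couple, so each of the four norms dominates, on the common
  -- intersection, some norm of the other couple.
  rcases pairs_equivalent_of_upper_bounds
      (R := DominatedOn (X.carrier ⊓ Y.carrier)) (DominatedOn.refl _) DominatedOn.trans
      (fun _ => DominatedOn.of_inter_embeds h.symm.inter_embeds h.inf_eq.le)
      (fun _ => DominatedOn.of_inter_embeds h.inter_embeds le_rfl)
      (t h rfl hXY) (t h.swap (inf_comm _ _) hYX) (t h.symm h.inf_eq hVW)
      (t h.symm.swap (h.inf_eq.trans (inf_comm _ _)) hWV) with
    ⟨h1, h2, h3, h4⟩ | ⟨h1, h2, h3, h4⟩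
  · exact h.carrier_eq_of_dominatedOn hXY hYX hVW hWV h1 h2 h3 h4
  · exact (h.swap'.carrier_eq_of_dominatedOn hXY hYX hWV hVW h1 h2 h3 h4).symm

end SameRankOneInterpolationSpaces

end BanachSubspace

theorem theorem2p8 {𝕜 E : Type*} [RCLike 𝕜] [AddCommGroup E] [Module 𝕜 E]
    (X Y V W : BanachSubspace 𝕜 E)
    (hXY : BanachSubspace.IsCouple X Y) (hVW : BanachSubspace.IsCouple V W)
    (h : BanachSubspace.rankOneInterpolationSpaces X Y =
      BanachSubspace.rankOneInterpolationSpaces V W) :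
    BanachSubspace.CoupleEquivalent X Y V W := by
  have hsame : BanachSubspace.SameRankOneInterpolationSpaces X Y V W := ⟨hXY, hVW, h⟩
  exact hsame.carrier_eq_or.imp
    (fun e => ⟨hsame.equivalent_of_eq e.1, hsame.swap.swap'.equivalent_of_eq e.2⟩)
    (fun e => ⟨hsame.swap'.equivalent_of_eq e.1, hsame.swap.equivalent_of_eq e.2⟩)
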